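/- Let $k$ be an algebraically closed field of characteristic $0$, and let $A = k\{x,y\}/(xy-yx-1)$ be the first Weyl algebra over $k$, with the $\mathbb{Z}$-grading given by $\deg x = 1$, $\deg y = -1$. Let $\operatorname{gr} A$ be the category of $\mathbb{Z}$-graded right $A$-modules with degree-preserving homomorphisms, and for $n \in \mathbb{Z}$ let $A\langle n\rangle$ be the graded right module $A$ with shifted grading $A\langle n\rangle_j = A_{j-n}$. Let $K_0 = K_0(\operatorname{gr} A)$ be the Grothendieck group of finitely generated graded projective right $A$-modules, that is, the group completion of the commutative monoid of their isomorphism classes in $\operatorname{gr} A$ under direct sum. Then: 1. $K_0$ is a free abelian group with basis the family of classes $([A\langle n\rangle])_{n\in\mathbb{Z}}$; in particular $K_0 \cong \mathbb{Z}^{(\mathbb{Z})}$ is a direct sum of countably infinitely many copies of $\mathbb{Z}$. 2. If $P$ and $P'$ are finitely generated graded projective right $A$-modules, then $[P] = [P']$ in $K_0$ if and only if $P \cong P'$ in $\operatorname{gr} A$. 3. Consequently cancellation holds: if $P$, $P'$, $Q$ are finitely generated graded projective right $A$-modules and $P \oplus Q \cong P' \oplus Q$ in $\operatorname{gr} A$,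 then $P \cong P'$ in $\operatorname{gr} A$. -/

import Mathlib

open scoped DirectSum
open MulOpposite

universe u

/-! ### Graded right modules over a `ℤ`-graded algebra -/

section GradedModules

variable {k R : Type u} [CommRing k] [Ring R] [Algebra k R]

/-- A `ℤ`-graded right `R`-module, for the algebra `R` with graded pieces `𝒜 i`. A right
`R`-module is a module over `Rᵐᵒᵖ`, so that `op r • m` is `m · r`. -/
structure GrMod (𝒜 : ℤ → Submodule k R) where
  carrier : Type u
  [addCommGroup : AddCommGroup carrier]
  [module : Module Rᵐᵒᵖ carrier]
  deg : ℤ → AddSubgroup carrier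
  isInternal : DirectSum.IsInternal deg
  smul_mem : ∀ {i j : ℤ} {r : R} {m : carrier}, r ∈ 𝒜 i → m ∈ deg j → op r • m ∈ deg (j + i)

attribute [instance] GrMod.addCommGroup GrMod.module

/-- Morphisms of graded right modules: `R`-linear maps that preserve degrees. -/
structure GrHom {𝒜 : ℤ → Submodule k R} (M N : GrMod 𝒜) where
  toLinearMap : M.carrier →ₗ[Rᵐᵒᵖ] N.carrier
  map_deg : ∀ (i : ℤ) (m : M.carrier), m ∈ M.deg i → toLinearMap m ∈ N.deg i

/-- Isomorphisms of graded right modules. -/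
structure GrIso {𝒜 : ℤ → Submodule k R} (M N : GrMod 𝒜) where
  toLinearEquiv : M.carrier ≃ₗ[Rᵐᵒᵖ] N.carrier
  map_deg_iff : ∀ (i : ℤ) (m : M.carrier), toLinearEquiv m ∈ N.deg i ↔ m ∈ M.deg i

namespace GrIso

variable {𝒜 : ℤ → Submodule k R}

/-- The identity isomorphism. -/
def refl (M : GrMod 𝒜) : GrIso M M := ⟨LinearEquiv.refl _ _, fun _ _ => Iff.rfl⟩

/-- The inverse isomorphism. -/
def symm {M N : GrMod 𝒜} (e : GrIso M N) : GrIso N M :=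
  ⟨e.toLinearEquiv.symm, fun i m => by
    rw [← e.map_deg_iff i, LinearEquiv.apply_symm_apply]⟩

/-- The composite of two isomorphisms. -/
def trans {M N L : GrMod 𝒜} (e : GrIso M N) (f : GrIso N L) : GrIso M L :=
  ⟨e.toLinearEquiv.trans f.toLinearEquiv, fun i m => by
    rw [LinearEquiv.trans_apply, f.map_deg_iff, e.map_deg_iff]⟩

end GrIso

namespace GrMod

variable {𝒜 : ℤ → Submodule k R}

theorem isInternal_of_components {M : Type u} [AddCommGroup M] {e : ℤ → AddSubgroup M}
    (D : M →+ ⨁ i, e i) (h1 : ∀ m, DirectSum.coeAddMonoidHom e (D m) = m)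
    (h2 : ∀ i x (hx : x ∈ e i), D x = DirectSum.of (fun i => e i) i ⟨x, hx⟩) :
    DirectSum.IsInternal e := by
  let _ : DirectSum.Decomposition e := DirectSum.Decomposition.ofAddHom e D
    (AddMonoidHom.ext h1) (by
      ext1 i
      ext1 ⟨x, hx⟩
      simp only [AddMonoidHom.comp_apply, DirectSum.coeAddMonoidHom_of, AddMonoidHom.id_apply]
      exact h2 i x hx)
  exact DirectSum.Decomposition.isInternal e

theorem isInternal_prod {M N : Type u} [AddCommGroup M] [AddCommGroup N]
    {d : ℤ → AddSubgroup M} {e : ℤ → AddSubgroup N}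
    (hd : DirectSum.IsInternal d) (he : DirectSum.IsInternal e) :
    DirectSum.IsInternal (fun i => (d i).prod (e i)) := by
  let _ := hd.chooseDecomposition
  let _ := he.chooseDecomposition
  let il : ∀ i, d i →+ (d i).prod (e i) := fun i =>
    ((AddMonoidHom.inl M N).comp (d i).subtype).codRestrict _
      fun x => AddSubgroup.mem_prod.2 ⟨x.2, (e i).zero_mem⟩
  let ir : ∀ i, e i →+ (d i).prod (e i) := fun i =>
    ((AddMonoidHom.inr M N).comp (e i).subtype).codRestrict _
      fun x => AddSubgroup.mem_prod.2 ⟨(d i).zero_mem, x.2⟩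
  let D : M × N →+ ⨁ i, (d i).prod (e i) := AddMonoidHom.coprod
    ((DirectSum.map il).comp (DirectSum.decomposeAddEquiv d).toAddMonoidHom)
    ((DirectSum.map ir).comp (DirectSum.decomposeAddEquiv e).toAddMonoidHom)
  have hl : ∀ i (x : M) (hx : x ∈ d i), D (x, 0) =
      DirectSum.of (fun i => (d i).prod (e i)) i
        ⟨(x, 0), AddSubgroup.mem_prod.2 ⟨hx, (e i).zero_mem⟩⟩ := by
    intro i x hx
    simp only [D, AddMonoidHom.coprod_apply, map_zero, add_zero]
    change DirectSum.map il (DirectSum.decompose d x) = _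
    rw [DirectSum.decompose_of_mem d hx, DirectSum.map_of]
    rfl
  have hr : ∀ i (x : N) (hx : x ∈ e i), D (0, x) =
      DirectSum.of (fun i => (d i).prod (e i)) i
        ⟨(0, x), AddSubgroup.mem_prod.2 ⟨(d i).zero_mem, hx⟩⟩ := by
    intro i x hx
    simp only [D, AddMonoidHom.coprod_apply, map_zero, zero_add]
    change DirectSum.map ir (DirectSum.decompose e x) = _
    rw [DirectSum.decompose_of_mem e hx, DirectSum.map_of]
    rfl
  have split : ∀ (x : M) (y : N), D (x, y) = D (x, 0) + D (0, y) := by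
    intro x y
    rw [← map_add]
    simp
  refine isInternal_of_components D ?_ ?_
  · have hx : ∀ x : M, DirectSum.coeAddMonoidHom _ (D (x, 0)) = (x, 0) := by
      intro x
      induction x using DirectSum.Decomposition.inductionOn d with
      | zero => exact (congrArg _ (map_zero D)).trans (map_zero _)
      | homogeneous m => rw [hl _ _ m.2, DirectSum.coeAddMonoidHom_of]
      | add m m' h h' =>
        have : ((m + m', 0) : M × N) = (m, 0) + (m', 0) := by simp
        rw [this, map_add, map_add, h, h']
    have hy : ∀ y : N, DirectSum.coeAddMonoidHom _ (D (0, y)) = (0, y) := by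
      intro y
      induction y using DirectSum.Decomposition.inductionOn e with
      | zero => exact (congrArg _ (map_zero D)).trans (map_zero _)
      | homogeneous m => rw [hr _ _ m.2, DirectSum.coeAddMonoidHom_of]
      | add m m' h h' =>
        have : ((0, m + m') : M × N) = (0, m) + (0, m') := by simp
        rw [this, map_add, map_add, h, h']
    rintro ⟨x, y⟩
    rw [split, map_add, hx, hy]
    simp
  · rintro i ⟨x, y⟩ hxy
    obtain ⟨hx, hy⟩ := AddSubgroup.mem_prod.1 hxy
    rw [split, hl i x hx, hr i y hy, ← map_add]
    congr 1
    ext <;> simp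

theorem isInternal_shift {M : Type u} [AddCommGroup M] {d : ℤ → AddSubgroup M}
    (hd : DirectSum.IsInternal d) (n : ℤ) : DirectSum.IsInternal (fun i => d (i - n)) := by
  let _ := hd.chooseDecomposition
  let c : ∀ i, d i →+ d (i + n - n) := fun i =>
    AddSubgroup.inclusion (le_of_eq (by rw [add_sub_cancel_right]))
  let D : M →+ ⨁ i, d (i - n) := (DirectSum.toAddMonoid fun i =>
    (DirectSum.of (fun j => d (j - n)) (i + n)).comp (c i)).comp
      (DirectSum.decomposeAddEquiv d).toAddMonoidHom
  have hD : ∀ i (x : M) (hx : x ∈ d i), D x =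
      DirectSum.of (fun j => d (j - n)) (i + n) ⟨x, by rwa [add_sub_cancel_right]⟩ := by
    intro i x hx
    change DirectSum.toAddMonoid _ (DirectSum.decompose d x) = _
    rw [DirectSum.decompose_of_mem d hx, DirectSum.toAddMonoid_of]
    rfl
  refine isInternal_of_components D ?_ ?_
  · intro x
    induction x using DirectSum.Decomposition.inductionOn d with
    | zero => exact (congrArg _ (map_zero D)).trans (map_zero _)
    | homogeneous m => rw [hD _ _ m.2, DirectSum.coeAddMonoidHom_of]
    | add m m' h h' => rw [map_add, map_add, h, h']
  · intro i x hx
    have : ∀ j, j = i → ∀ h : x ∈ d (j - n), DirectSum.of (fun j => d (j - n)) j ⟨x, h⟩ =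
        DirectSum.of (fun j => d (j - n)) i ⟨x, hx⟩ := by
      rintro _ rfl _
      rfl
    rw [hD _ x hx]
    exact this _ (sub_add_cancel i n) _

theorem isInternal_of_subsingleton {M : Type u} [AddCommGroup M] [Subsingleton M]
    (d : ℤ → AddSubgroup M) : DirectSum.IsInternal d :=
  isInternal_of_components 0 (fun _ => Subsingleton.elim _ _) fun i x hx => by
    have : (⟨x, hx⟩ : d i) = 0 := Subtype.ext (Subsingleton.elim _ _)
    rw [this, map_zero, AddMonoidHom.zero_apply]

/-- The direct sum of two graded modules. -/
def sum (M N : GrMod 𝒜) : GrMod 𝒜 where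
  carrier := M.carrier × N.carrier
  deg i := (M.deg i).prod (N.deg i)
  isInternal := isInternal_prod M.isInternal N.isInternal
  smul_mem hr hm := ⟨M.smul_mem hr hm.1, N.smul_mem hr hm.2⟩

/-- The zero module. -/
def zero (𝒜 : ℤ → Submodule k R) : GrMod 𝒜 where
  carrier := PUnit
  deg _ := ⊥
  isInternal := isInternal_of_subsingleton _
  smul_mem _ _ := rfl

/-- The shift `M⟨n⟩`, with the convention `M⟨n⟩_j = M_{j-n}`. -/
def shift (M : GrMod 𝒜) (n : ℤ) : GrMod 𝒜 where
  carrier := M.carrier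
  deg j := M.deg (j - n)
  isInternal := isInternal_shift M.isInternal n
  smul_mem {i j _ _} hr hm := by
    have := M.smul_mem hr hm
    rwa [sub_add_eq_add_sub] at this

/-- The algebra `R` as a graded right module over itself. -/
def self (𝒜 : ℤ → Submodule k R) [GradedAlgebra 𝒜] : GrMod 𝒜 where
  carrier := R
  deg i := (𝒜 i).toAddSubgroup
  isInternal := DirectSum.Decomposition.isInternal 𝒜
  smul_mem hr hm := SetLike.mul_mem_graded (A := 𝒜) hm hr

/-- `P` is projective in the category of graded right modules: degree-preserving maps out of `P`
lift along surjective degree-preserving maps. -/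
def IsProjective (P : GrMod 𝒜) : Prop :=
  ∀ (M N : GrMod 𝒜) (g : GrHom M N) (f : GrHom P N), Function.Surjective g.toLinearMap →
    ∃ h : GrHom P M, g.toLinearMap ∘ₗ h.toLinearMap = f.toLinearMap

/-- `P` is finitely generated as a right `R`-module. -/
def IsFG (P : GrMod 𝒜) : Prop := Module.Finite Rᵐᵒᵖ P.carrier

theorem isProjective_sum {P Q : GrMod 𝒜} (hP : P.IsProjective) (hQ : Q.IsProjective) :
    (P.sum Q).IsProjective := by
  intro M N g f hg
  let fP : GrHom P N := ⟨f.toLinearMap ∘ₗ LinearMap.inl _ P.carrier Q.carrier,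
    fun i m hm => f.map_deg i _ ⟨hm, (Q.deg i).zero_mem⟩⟩
  let fQ : GrHom Q N := ⟨f.toLinearMap ∘ₗ LinearMap.inr _ P.carrier Q.carrier,
    fun i m hm => f.map_deg i _ ⟨(P.deg i).zero_mem, hm⟩⟩
  obtain ⟨a, ha⟩ := hP M N g fP hg
  obtain ⟨b, hb⟩ := hQ M N g fQ hg
  refine ⟨⟨LinearMap.coprod a.toLinearMap b.toLinearMap, fun i m hm => ?_⟩, ?_⟩
  · exact (M.deg i).add_mem (a.map_deg i _ hm.1) (b.map_deg i _ hm.2)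
  · refine LinearMap.ext fun m => ?_
    have h1 : g.toLinearMap (a.toLinearMap m.1) = f.toLinearMap ((m.1, 0) : _ × _) :=
      LinearMap.congr_fun ha m.1
    have h2 : g.toLinearMap (b.toLinearMap m.2) = f.toLinearMap ((0, m.2) : _ × _) :=
      LinearMap.congr_fun hb m.2
    have h3 : m = ((m.1, 0) + (0, m.2) : P.carrier × Q.carrier) :=
      Prod.ext (add_zero _).symm (zero_add _).symm
    change g.toLinearMap (a.toLinearMap m.1 + b.toLinearMap m.2) = _
    rw [map_add, h1, h2]
    exact (map_add f.toLinearMap _ _).symm.trans (congrArg f.toLinearMap h3.symm)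

theorem isProjective_zero : (zero 𝒜).IsProjective := by
  intro M N g f _
  refine ⟨⟨0, fun i m _ => (M.deg i).zero_mem⟩, ?_⟩
  refine LinearMap.ext fun x => ?_
  exact (map_zero g.toLinearMap).trans (map_zero f.toLinearMap).symm

theorem isProjective_self_shift [GradedAlgebra 𝒜] (n : ℤ) :
    ((self 𝒜).shift n).IsProjective := by
  intro M N g f hg
  let _ := M.isInternal.chooseDecomposition
  let _ := N.isInternal.chooseDecomposition
  have h1 : f.toLinearMap (1 : R) ∈ N.deg n := by
    refine f.map_deg n _ ?_
    change (1 : R) ∈ 𝒜 (n - n)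
    rw [sub_self]
    exact SetLike.GradedOne.one_mem
  obtain ⟨m, hm⟩ := hg (f.toLinearMap (1 : R))
  have key : ∀ m : M.carrier, g.toLinearMap (DirectSum.decompose M.deg m n : M.carrier) =
      (DirectSum.decompose N.deg (g.toLinearMap m) n : N.carrier) := by
    intro m
    induction m using DirectSum.Decomposition.inductionOn M.deg with
    | zero => simp
    | @homogeneous i m =>
      by_cases hi : i = n
      · subst hi
        rw [DirectSum.decompose_of_mem_same _ m.2,
          DirectSum.decompose_of_mem_same _ (g.map_deg _ _ m.2)]
      · rw [DirectSum.decompose_of_mem_ne _ m.2 hi,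
          DirectSum.decompose_of_mem_ne _ (g.map_deg _ _ m.2) hi, map_zero]
    | add m m' h h' => simp [h, h']
  let c : M.carrier := (DirectSum.decompose M.deg m n : M.carrier)
  have hc : g.toLinearMap c = f.toLinearMap (1 : R) := by
    rw [key, hm, DirectSum.decompose_of_mem_same _ h1]
  have e1 : ∀ r : R, op r • (1 : R) = r := fun r => by simp
  let φ : R →ₗ[Rᵐᵒᵖ] M.carrier :=
    { toFun := fun r => op r • c
      map_add' := fun r s => by rw [op_add, add_smul]
      map_smul' := fun a r => by
        rw [RingHom.id_apply, ← mul_smul]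
        rfl }
  refine ⟨⟨φ, fun i r hr => ?_⟩, LinearMap.ext fun r => ?_⟩
  · have := M.smul_mem (i := i - n) (r := r) hr (DirectSum.decompose M.deg m n).2
    rwa [add_sub_cancel] at this
  · change g.toLinearMap ((op r : Rᵐᵒᵖ) • c) = f.toLinearMap r
    rw [map_smul, hc]
    exact (map_smul f.toLinearMap (op r : Rᵐᵒᵖ) (1 : R)).symm.trans
      (congrArg f.toLinearMap (e1 r))

theorem finite_op_self (R : Type u) [Ring R] : Module.Finite Rᵐᵒᵖ R :=
  ⟨⟨{(1 : R)}, by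
    refine eq_top_iff.2 fun r _ => ?_
    have h : op r • (1 : R) = r := by simp
    have := Submodule.smul_mem (Submodule.span Rᵐᵒᵖ {(1 : R)}) (op r)
      (Submodule.mem_span_singleton_self 1)
    rw [h] at this
    simpa using this⟩⟩

theorem isFG_self_shift [GradedAlgebra 𝒜] (n : ℤ) : ((self 𝒜).shift n).IsFG :=
  finite_op_self R

end GrMod

/-! ### The Grothendieck group -/

/-- Finitely generated graded projective right modules. -/
structure FGProj (𝒜 : ℤ → Submodule k R) where
  toGrMod : GrMod 𝒜
  isFG : toGrMod.IsFG
  isProjective : toGrMod.IsProjective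

namespace FGProj

/-- The direct sum `P ⊕ Q`. -/
def sum {𝒜 : ℤ → Submodule k R} (P Q : FGProj 𝒜) : FGProj 𝒜 where
  toGrMod := P.toGrMod.sum Q.toGrMod
  isFG := by
    have := P.isFG
    have := Q.isFG
    unfold GrMod.IsFG at *
    exact inferInstanceAs (Module.Finite Rᵐᵒᵖ (P.toGrMod.carrier × Q.toGrMod.carrier))
  isProjective := GrMod.isProjective_sum P.isProjective Q.isProjective

/-- The zero module. -/
def zero (𝒜 : ℤ → Submodule k R) : FGProj 𝒜 where
  toGrMod := GrMod.zero 𝒜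
  isFG := inferInstanceAs (Module.Finite Rᵐᵒᵖ PUnit.{u + 1})
  isProjective := GrMod.isProjective_zero

/-- The shift `R⟨n⟩` of the free module of rank one. -/
def free (𝒜 : ℤ → Submodule k R) [GradedAlgebra 𝒜] (n : ℤ) : FGProj 𝒜 where
  toGrMod := (GrMod.self 𝒜).shift n
  isFG := GrMod.isFG_self_shift n
  isProjective := GrMod.isProjective_self_shift n

/-- Isomorphism in the category of graded modules. -/
instance setoid (𝒜 : ℤ → Submodule k R) : Setoid (FGProj 𝒜) where
  r P Q := Nonempty (GrIso P.toGrMod Q.toGrMod)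
  iseqv := ⟨fun _ => ⟨GrIso.refl _⟩, fun ⟨e⟩ => ⟨e.symm⟩, fun ⟨e⟩ ⟨f⟩ => ⟨e.trans f⟩⟩

end FGProj

/-- Isomorphism classes of finitely generated graded projective right modules. -/
def FGProjClass (𝒜 : ℤ → Submodule k R) : Type (u + 1) := Quotient (FGProj.setoid 𝒜)

/-- The sum of isomorphism classes, given by the direct sum. -/
instance FGProjClass.add (𝒜 : ℤ → Submodule k R) : Add (FGProjClass 𝒜) where
  add := Quotient.map₂ FGProj.sum fun _ _ ⟨e⟩ _ _ ⟨f⟩ =>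
    ⟨⟨e.toLinearEquiv.prodCongr f.toLinearEquiv, fun i m =>
      and_congr (e.map_deg_iff i m.1) (f.map_deg_iff i m.2)⟩⟩

/-- The class of the zero module. -/
instance FGProjClass.zero (𝒜 : ℤ → Submodule k R) : Zero (FGProjClass 𝒜) where
  zero := Quotient.mk _ (FGProj.zero 𝒜)

/-- Isomorphism classes form a commutative monoid under direct sum. -/
instance FGProjClass.addCommMonoid (𝒜 : ℤ → Submodule k R) : AddCommMonoid (FGProjClass 𝒜) where
  add_assoc := by
    rintro ⟨P⟩ ⟨Q⟩ ⟨S⟩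
    exact Quotient.sound ⟨⟨LinearEquiv.prodAssoc _ P.toGrMod.carrier Q.toGrMod.carrier
      S.toGrMod.carrier, fun i m => and_assoc.symm⟩⟩
  zero_add := by
    rintro ⟨P⟩
    exact Quotient.sound ⟨⟨(LinearEquiv.uniqueProd : (PUnit.{u + 1} × P.toGrMod.carrier) ≃ₗ[Rᵐᵒᵖ] _),
      fun i m => ⟨fun h => ⟨rfl, h⟩, fun h => h.2⟩⟩⟩
  add_zero := by
    rintro ⟨P⟩
    exact Quotient.sound ⟨⟨(LinearEquiv.prodUnique : (P.toGrMod.carrier × PUnit.{u + 1}) ≃ₗ[Rᵐᵒᵖ] _),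
      fun i m => ⟨fun h => ⟨h, rfl⟩, fun h => h.1⟩⟩⟩
  add_comm := by
    rintro ⟨P⟩ ⟨Q⟩
    exact Quotient.sound ⟨⟨LinearEquiv.prodComm _ P.toGrMod.carrier Q.toGrMod.carrier,
      fun i m => and_comm⟩⟩
  nsmul := nsmulRec

/-- The Grothendieck group `K₀` of the category of graded right modules: the group completion of
the monoid of isomorphism classes of finitely generated graded projective modules. -/
abbrev GrK0 (𝒜 : ℤ → Submodule k R) : Type (u + 1) :=
  Algebra.GrothendieckAddGroup (FGProjClass 𝒜)

/-- The class `[P]` in `K₀`. -/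
def GrK0.cls {𝒜 : ℤ → Submodule k R} (P : FGProj 𝒜) : GrK0 𝒜 :=
  Algebra.GrothendieckAddGroup.of (Quotient.mk _ P : FGProjClass 𝒜)

end GradedModules

/-! ### The Weyl algebra -/

section Weyl

/-- The two generators of the Weyl algebra. -/
inductive WeylGen : Type
  | x
  | y

/-- The defining relation `xy - yx = 1`, written as `xy = yx + 1`. -/
inductive WeylRel (k : Type u) [CommRing k] :
    FreeAlgebra k WeylGen → FreeAlgebra k WeylGen → Prop
  | comm : WeylRel k (FreeAlgebra.ι k .x * FreeAlgebra.ι k .y)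
      (FreeAlgebra.ι k .y * FreeAlgebra.ι k .x + 1)

/-- The first Weyl algebra `k{x, y} / (xy - yx - 1)`. -/
abbrev Weyl (k : Type u) [CommRing k] : Type u := RingQuot (WeylRel k)

variable (k : Type u) [CommRing k]

namespace Weyl

/-- The images of the generators in the Weyl algebra. -/
def gen (g : WeylGen) : Weyl k := RingQuot.mkAlgHom k (WeylRel k) (FreeAlgebra.ι k g)

/-- The degrees of the generators: `deg x = 1` and `deg y = -1`. -/
def genDeg : WeylGen → ℤ
  | .x => 1
  | .y => -1

/-- The Euler grading: the piece of degree `n` is spanned by the monomials (words) in `x` and `y`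
whose total degree is `n`. -/
def grading (n : ℤ) : Submodule k (Weyl k) :=
  Submodule.span k {a | ∃ w : List WeylGen, (w.map genDeg).sum = n ∧ (w.map (gen k)).prod = a}

theorem gen_rel : gen k .x * gen k .y = gen k .y * gen k .x + 1 := by
  have := RingQuot.mkAlgHom_rel k (WeylRel.comm (k := k))
  simpa [gen] using this

theorem gen_mem (g : WeylGen) : gen k g ∈ grading k (genDeg g) :=
  Submodule.subset_span ⟨[g], by simp, by simp⟩

instance gradedMonoid : SetLike.GradedMonoid (grading k) where
  one_mem := Submodule.subset_span ⟨[], by simp, by simp⟩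
  mul_mem := by
    intro i j a b ha hb
    have h := Submodule.mul_mem_mul ha hb
    rw [grading, grading, Submodule.span_mul_span] at h
    refine Submodule.span_mono ?_ h
    rintro _ ⟨a, ⟨v, hv, rfl⟩, b, ⟨w, hw, rfl⟩, rfl⟩
    exact ⟨v ++ w, by simp [hv, hw], by simp⟩

theorem of_congr {i j : ℤ} (h : i = j) {a b : Weyl k} (hab : a = b) (ha : a ∈ grading k i)
    (hb : b ∈ grading k j) : DirectSum.of (fun n => grading k n) i ⟨a, ha⟩ =
      DirectSum.of (fun n => grading k n) j ⟨b, hb⟩ := by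
  subst h hab
  rfl

theorem of_gen_rel :
    DirectSum.of (fun n => grading k n) (genDeg .x) ⟨gen k .x, gen_mem k .x⟩ *
      DirectSum.of (fun n => grading k n) (genDeg .y) ⟨gen k .y, gen_mem k .y⟩ =
    DirectSum.of (fun n => grading k n) (genDeg .y) ⟨gen k .y, gen_mem k .y⟩ *
      DirectSum.of (fun n => grading k n) (genDeg .x) ⟨gen k .x, gen_mem k .x⟩ + 1 := by
  have hyx : gen k .y * gen k .x ∈ grading k 0 := by
    have h := SetLike.mul_mem_graded (gen_mem k .y) (gen_mem k .x)
    rwa [show genDeg .y + genDeg .x = 0 from rfl] at h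
  have hone : (1 : Weyl k) ∈ grading k 0 := SetLike.one_mem_graded (grading k)
  have hsum : gen k .y * gen k .x + 1 ∈ grading k 0 := add_mem hyx hone
  have h1 : (1 : ⨁ n, grading k n) = DirectSum.of (fun n => grading k n) 0 ⟨1, hone⟩ := rfl
  have h2 : (⟨_, hsum⟩ : grading k 0) = ⟨_, hyx⟩ + ⟨_, hone⟩ := rfl
  rw [DirectSum.of_mul_of, DirectSum.of_mul_of, h1]
  have hl := of_congr k (i := genDeg .x + genDeg .y) (j := 0) (by decide) (gen_rel k)
    (SetLike.mul_mem_graded (gen_mem k .x) (gen_mem k .y)) hsum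
  have hr := of_congr k (i := genDeg .y + genDeg .x) (j := 0) (by decide) rfl
    (SetLike.mul_mem_graded (gen_mem k .y) (gen_mem k .x)) hyx
  rw [h2, map_add, ← hr] at hl
  exact hl

/-- The algebra map that sends an element to its family of homogeneous components. -/
noncomputable def components : Weyl k →ₐ[k] ⨁ n, grading k n :=
  RingQuot.liftAlgHom k ⟨FreeAlgebra.lift k fun g =>
    DirectSum.of (fun n => grading k n) (genDeg g) ⟨gen k g, gen_mem k g⟩, by
    rintro _ _ ⟨⟩
    rw [map_mul, map_add, map_mul, map_one, FreeAlgebra.lift_ι_apply, FreeAlgebra.lift_ι_apply]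
    exact of_gen_rel k⟩

theorem components_gen (g : WeylGen) : components k (gen k g) =
    DirectSum.of (fun n => grading k n) (genDeg g) ⟨gen k g, gen_mem k g⟩ := by
  simp [components, gen]

/-- The Weyl algebra is a graded algebra. -/
noncomputable instance gradedAlgebra : GradedAlgebra (grading k) :=
  GradedAlgebra.ofAlgHom (grading k) (components k)
    (by
      refine RingQuot.ringQuot_ext' _ _ _ (FreeAlgebra.hom_ext (funext fun g => ?_))
      change DirectSum.coeAlgHom (grading k) (components k (gen k g)) = gen k g
      rw [components_gen, DirectSum.coeAlgHom_of])
    (by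
      have hw : ∀ w : List WeylGen, ∀ h, components k (w.map (gen k)).prod =
          DirectSum.of (fun n => grading k n) (w.map genDeg).sum ⟨(w.map (gen k)).prod, h⟩ := by
        intro w
        induction w with
        | nil => intro h; exact map_one _
        | cons g w ih =>
          intro h
          have hw := Submodule.subset_span (R := k) (s := {a : Weyl k | ∃ v : List WeylGen,
            (v.map genDeg).sum = (w.map genDeg).sum ∧ (v.map (gen k)).prod = a}) ⟨w, rfl, rfl⟩
          have e : components k ((g :: w).map (gen k)).prod =
              components k (gen k g) * components k (w.map (gen k)).prod := by
            rw [List.map_cons, List.prod_cons, map_mul]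
          rw [e, components_gen, ih hw, DirectSum.of_mul_of]
          exact of_congr k (by simp) (by simp) _ _
      rintro n ⟨a, ha⟩
      induction ha using Submodule.span_induction with
      | mem a h =>
        obtain ⟨w, rfl, rfl⟩ := h
        exact hw w _
      | zero => exact (map_zero _).trans (map_zero (DirectSum.of (fun n => grading k n) n)).symm
      | add a b ha hb iha ihb =>
        change components k (a + b) = _
        rw [map_add, iha, ihb, ← map_add]
        rfl
      | smul c a ha iha =>
        change components k (c • a) = _
        rw [map_smul, iha]
        exact ((DirectSum.lof k ℤ (fun n => grading k n) n).map_smul c ⟨a, ha⟩).symm)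

end Weyl

end Weyl

/-! A graded projective module `P` is turned into a chain of lattices, and the chain into linear
algebra over `k`. Each component `P_j` is a `k[X]`-module with `X` acting as `yx`. It is finitely
generated, as a quotient of a component of a free module, and torsion-free, because `P` embeds in
that free module. Right multiplication by `x` is injective, and it is surjective in high degrees, so
all the `P_j` sit in one copy of `k[X]^r`, as lattices `Λ_j`. In suitably shifted coordinates
(`exists_coord`), `x` becomes an inclusion `Λ_j ⊆ Λ_{j+1}`, and `y` becomes multiplication by `X +
j` from `Λ_j` to `Λ_{j-1}`.

Hence `X + j + 1` kills `Λ_{j+1} / Λ_j`. The roots `-j - 1` are distinct in characteristic `0`, so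
the chain is determined by the images of `Λ_i` in the fibres `k^r` at `-i - 1` (`mem_chain_iff`).
These subspaces are zero for `i` far to the left and everything for `i` far to the right.
Transvections over `k[X]` interpolate transvections prescribed at finitely many points, so
automorphisms of `k[X]^r` exchange any two such families with equal dimensions
(`exists_equiv_of_finrank_eq`). Therefore `P` is determined up to isomorphism by the numbers `defect
P j`, which are the codimensions of the subspaces (`nonempty_grIso_of_defect_eq`).

The defect is additive, vanishes for large `j`, and for `A⟨n⟩` is the indicator of `j < n`
(`defect_free`). Its successive differences form a homomorphism to `ℤ →₀ ℤ` that is injective on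
isomorphism classes and sends `A⟨n⟩` to the `n`-th basis vector. An injective homomorphism from the
monoid of classes to a group yields the comparison of classes and cancellation, and the induced map
on `K₀` is an isomorphism that gives the basis. -/

/-! ### Lattices in `k[X]^r` -/

section Lattices

open Polynomial

variable {k : Type*} [Field k] {r : ℕ}

/-- Coordinatewise evaluation of a vector of polynomials. -/
noncomputable def vecEval (c : k) : (Fin r → k[X]) →ₗ[k] (Fin r → k) :=
  (Polynomial.leval c).compLeft (Fin r)

@[simp]
theorem vecEval_apply (c : k) (v : Fin r → k[X]) (i : Fin r) : vecEval c v i = (v i).eval c := rfl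

theorem vecEval_smul (c : k) (p : k[X]) (v : Fin r → k[X]) :
    vecEval c (p • v) = p.eval c • vecEval c v := by
  ext i
  simp

/-- The vector of constant polynomials with given values. -/
noncomputable def vecConst (w : Fin r → k) : Fin r → k[X] := fun i => C (w i)

@[simp]
theorem vecEval_vecConst (c : k) (w : Fin r → k) : vecEval c (vecConst w) = w := by
  ext i
  simp [vecConst]

theorem exists_of_vecEval_eq_zero {c : k} {v : Fin r → k[X]} (h : vecEval c v = 0) :
    ∃ u : Fin r → k[X], v = (X - C c) • u := by
  have : ∀ i, ∃ q, v i = (X - C c) * q := fun i => by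
    have h1 : (v i).eval c = 0 := congrFun h i
    exact dvd_iff_isRoot.2 h1
  choose u hu using this
  exact ⟨u, funext hu⟩

/-- The extension to `k[X]^r` of a linear functional on `k^r`. -/
noncomputable def functionalExt (f : Module.Dual k (Fin r → k)) :
    Module.Dual k[X] (Fin r → k[X]) :=
  ∑ i, C (f (Pi.single i 1)) • LinearMap.proj i

theorem functionalExt_apply (f : Module.Dual k (Fin r → k)) (v : Fin r → k[X]) :
    functionalExt f v = ∑ i, C (f (Pi.single i 1)) * v i := by
  simp [functionalExt]

theorem functional_eq_sum (f : Module.Dual k (Fin r → k)) (w : Fin r → k) :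
    f w = ∑ i, f (Pi.single i 1) * w i := by
  conv_lhs => rw [pi_eq_sum_univ' w]
  simp only [map_sum, map_smul, smul_eq_mul]
  refine Finset.sum_congr rfl fun i _ => ?_
  rw [mul_comm]

theorem eval_functionalExt (f : Module.Dual k (Fin r → k)) (c : k) (v : Fin r → k[X]) :
    (functionalExt f v).eval c = f (vecEval c v) := by
  rw [functionalExt_apply, functional_eq_sum f (vecEval c v), eval_finsetSum]
  simp

theorem functionalExt_vecConst (f : Module.Dual k (Fin r → k)) (w : Fin r → k) :
    functionalExt f (vecConst w) = C (f w) := by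
  rw [functionalExt_apply, functional_eq_sum f w, map_sum]
  simp [vecConst]

/-- A transvection of `k^r` at the point `c` lifts to an automorphism of `k[X]^r` that is
the identity at the points of a finite set. -/
theorem exists_lift_transvection (T : Finset k) {c : k} (hc : c ∉ T)
    {f : Module.Dual k (Fin r → k)} {e : Fin r → k} (hfe : f e = 0) :
    ∃ ψ : (Fin r → k[X]) ≃ₗ[k[X]] (Fin r → k[X]),
      (∀ t ∈ T, ∀ v, vecEval t (ψ v) = vecEval t v) ∧
      ∀ v, vecEval c (ψ v) = LinearEquiv.transvection hfe (vecEval c v) := by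
  -- Lagrange interpolation: `q` is `1` at `c` and `0` on `T`. Scaling the functional by `q` turns
  -- the transvection on at `c` and off on `T`.
  let q0 : k[X] := ∏ t ∈ T, (X - C t)
  have hq0 : q0.eval c ≠ 0 := by
    rw [eval_prod, Finset.prod_ne_zero_iff]
    intro t ht
    simpa [sub_eq_zero] using fun h : c = t => hc (h ▸ ht)
  let q : k[X] := C (q0.eval c)⁻¹ * q0
  have hqc : q.eval c = 1 := by simp [q, hq0]
  have hqT : ∀ t ∈ T, q.eval t = 0 := fun t ht => by
    have : q0.eval t = 0 := by
      rw [eval_prod]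
      exact Finset.prod_eq_zero ht (by simp)
    simp [q, this]
  have h0 : (q • functionalExt f) (vecConst e) = 0 := by
    simp [functionalExt_vecConst, hfe]
  refine ⟨LinearEquiv.transvection h0, fun t ht v => ?_, fun v => ?_⟩
  · rw [LinearEquiv.transvection.apply, map_add, vecEval_smul]
    simp [hqT t ht]
  · rw [LinearEquiv.transvection.apply, LinearEquiv.transvection.apply, map_add, vecEval_smul]
    simp [hqc, eval_functionalExt]

/-- Since `u` and `w` are independent modulo `A`, the vector `u` lies outside `A + k(w - u)`, and a
functional separates them. The transvection that it defines along `w - u` fixes `A` pointwise and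
moves `u` to `w`. -/
theorem exists_dual_eq_one {V : Type*} [AddCommGroup V] [Module k V] {A : Submodule k V} {u w : V}
    (h : ∀ a b : k, a • u + b • w ∈ A → a = 0 ∧ b = 0) :
    ∃ f : Module.Dual k V, (∀ v ∈ A, f v = 0) ∧ f u = 1 ∧ f (w - u) = 0 := by
  have hu : u ∉ A ⊔ Submodule.span k {w - u} := by
    intro hmem
    obtain ⟨a, ha, s, hs, has⟩ := Submodule.mem_sup.1 hmem
    obtain ⟨c, rfl⟩ := Submodule.mem_span_singleton.1 hs
    have : (1 + c) • u + (-c) • w = a := by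
      rw [eq_sub_of_add_eq has]
      module
    obtain ⟨h1, h2⟩ := h _ _ (this ▸ ha)
    rw [neg_eq_zero] at h2
    simp [h2] at h1
  obtain ⟨f, hf, hfA⟩ := Submodule.exists_le_ker_of_notMem hu
  refine ⟨(f u)⁻¹ • f, fun v hv => ?_, by simp [hf], ?_⟩
  · have : f v = 0 := hfA (Submodule.mem_sup_left hv)
    simp [this]
  · have : f (w - u) = 0 := hfA (Submodule.mem_sup_right (Submodule.mem_span_singleton_self _))
    rw [LinearMap.smul_apply, this, smul_zero]

/-- Two subspaces of the same dimension of the fibre at `c` are exchanged by an automorphism of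
`k[X]^r` that is the identity at the points of a finite set. -/
theorem exists_equiv_subspace (T : Finset k) {c : k} (hc : c ∉ T)
    (U U' : Submodule k (Fin r → k)) (h : Module.finrank k U = Module.finrank k U') :
    ∃ ψ : (Fin r → k[X]) ≃ₗ[k[X]] (Fin r → k[X]),
      (∀ t ∈ T, ∀ v, vecEval t (ψ v) = vecEval t v) ∧
      ∀ v, vecEval c (ψ v) ∈ U' ↔ vecEval c v ∈ U := by
  -- Induction on the codimension of `U ⊓ U'` in `U'`: each transvection moves a vector of `U`
  -- outside `U'` to one of `U'` outside `U`.
  induction hn : Module.finrank k U' - Module.finrank k (U ⊓ U' : Submodule k (Fin r → k))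
    using Nat.strong_induction_on generalizing U with
  | _ n ih =>
  by_cases hUU : U ≤ U'
  · obtain rfl := Submodule.eq_of_le_of_finrank_eq hUU h
    exact ⟨LinearEquiv.refl _ _, by simp, by simp⟩
  have hUU' : ¬ U' ≤ U := fun h' => hUU (Submodule.eq_of_le_of_finrank_eq h' h.symm).ge
  obtain ⟨u, huU, huU'⟩ := Set.not_subset.1 hUU
  obtain ⟨w, hwU', hwU⟩ := Set.not_subset.1 hUU'
  simp only [SetLike.mem_coe] at huU huU' hwU hwU'
  obtain ⟨f, hfA, hfu, hfe⟩ := exists_dual_eq_one (A := U ⊓ U') (u := u) (w := w) (by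
    rintro a b ⟨h1, h2⟩
    have hb : b = 0 := by
      by_contra hb
      have := U.sub_mem h1 (U.smul_mem a huU)
      rw [add_sub_cancel_left] at this
      exact hwU ((U.smul_mem_iff hb).1 this)
    subst hb
    rw [zero_smul, add_zero] at h2
    refine ⟨?_, rfl⟩
    by_contra ha
    exact huU' ((U'.smul_mem_iff ha).1 h2))
  obtain ⟨ψ, hψT, hψc⟩ := exists_lift_transvection T hc hfe
  set g := LinearEquiv.transvection hfe
  let U₁ : Submodule k (Fin r → k) := U.map g.toLinearMap
  have hU₁ : Module.finrank k U₁ = Module.finrank k U' := by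
    rw [← h]
    exact LinearEquiv.finrank_map_eq g U
  have hlt : U ⊓ U' < U₁ ⊓ U' := by
    refine (SetLike.lt_iff_le_and_exists (A := Submodule k (Fin r → k))
      (B := Fin r → k)).2 ⟨fun v hv => ⟨⟨v, hv.1, ?_⟩, hv.2⟩, w,
      ⟨⟨u, huU, ?_⟩, hwU'⟩, fun hw => hwU hw.1⟩
    · change v + f v • (w - u) = v
      rw [hfA v hv, zero_smul, add_zero]
    · change u + f u • (w - u) = w
      rw [hfu, one_smul, add_sub_cancel]
  have h1 := Submodule.finrank_lt_finrank_of_lt hlt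
  have h2 := Submodule.finrank_mono (inf_le_right : U₁ ⊓ U' ≤ U')
  obtain ⟨ψ', hT', hc'⟩ := ih _ (by omega) U₁ hU₁ rfl
  refine ⟨ψ.trans ψ', fun t ht v => ?_, fun v => ?_⟩
  · rw [LinearEquiv.trans_apply, hT' t ht, hψT t ht]
  · rw [LinearEquiv.trans_apply, hc', hψc]
    exact (Submodule.mem_map_equiv (e := g) U).trans (by rw [LinearEquiv.symm_apply_apply])

/-- The points of `S` are treated one at a time. The set `T` of protected fibres varies in the
induction: the earlier automorphism must be the identity at the new point, and the new one at the
points already treated. -/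
theorem exists_equiv_subspaces (S T : Finset k) (hST : Disjoint S T)
    (U U' : k → Submodule k (Fin r → k))
    (h : ∀ c, Module.finrank k (U c) = Module.finrank k (U' c)) :
    ∃ ψ : (Fin r → k[X]) ≃ₗ[k[X]] (Fin r → k[X]),
      (∀ t ∈ T, ∀ v, vecEval t (ψ v) = vecEval t v) ∧
      ∀ c ∈ S, ∀ v, vecEval c (ψ v) ∈ U' c ↔ vecEval c v ∈ U c := by
  classical
  induction S using Finset.induction_on generalizing T with
  | empty => exact ⟨LinearEquiv.refl _ _, by simp, by simp⟩
  | insert a S ha ih =>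
    rw [Finset.disjoint_insert_left] at hST
    obtain ⟨ψ, hT, hS⟩ := ih (insert a T) (Finset.disjoint_insert_right.2 ⟨ha, hST.2⟩)
    obtain ⟨ψ', hT', ha'⟩ := exists_equiv_subspace (S ∪ T) (c := a)
      (by simp [ha, hST.1]) (U a) (U' a) (h a)
    refine ⟨ψ.trans ψ', fun t ht v => ?_, fun c hc v => ?_⟩
    · rw [LinearEquiv.trans_apply, hT' t (Finset.mem_union_right _ ht),
        hT t (Finset.mem_insert_of_mem ht)]
    · rw [LinearEquiv.trans_apply]
      rcases Finset.mem_insert.1 hc with rfl | hc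
      · rw [ha', hT _ (Finset.mem_insert_self _ _)]
      · rw [hT' c (Finset.mem_union_left _ hc), hS c hc]

/-- The kernel of evaluation at `c` is `(X - c) k[X]^r`, which every `k[X]`-linear automorphism
preserves. -/
theorem vecEval_equiv_eq_zero_iff (ψ : (Fin r → k[X]) ≃ₗ[k[X]] (Fin r → k[X])) (c : k)
    (v : Fin r → k[X]) : vecEval c (ψ v) = 0 ↔ vecEval c v = 0 := by
  have key : ∀ (ψ : (Fin r → k[X]) ≃ₗ[k[X]] (Fin r → k[X])) v, vecEval c v = 0 →
      vecEval c (ψ v) = 0 := by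
    intro ψ v h
    obtain ⟨u, rfl⟩ := exists_of_vecEval_eq_zero h
    rw [map_smul, vecEval_smul]
    simp
  exact ⟨fun h => by simpa using key ψ.symm _ h, key ψ v⟩

/-- Families of subspaces of the fibres at the integers, trivial near `±∞`, are exchanged by an
automorphism of `k[X]^r` as soon as their dimensions agree. -/
theorem exists_equiv_of_finrank_eq [CharZero k] (U U' : ℤ → Submodule k (Fin r → k))
    (h : ∀ i, Module.finrank k (U i) = Module.finrank k (U' i))
    {M N : ℤ} (hM : ∀ i < M, U i = ⊥) (hN : ∀ i, N ≤ i → U i = ⊤) :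
    ∃ ψ : (Fin r → k[X]) ≃ₗ[k[X]] (Fin r → k[X]),
      ∀ (i : ℤ) v, vecEval (-(i : k) - 1) (ψ v) ∈ U' i ↔ vecEval (-(i : k) - 1) v ∈ U i := by
  classical
  let pt : ℤ → k := fun i => -(i : k) - 1
  have hpt : Function.Injective pt := fun i j hij => by
    simpa [pt] using hij
  -- Only the indices in `[M, N)` impose a condition. The families are reindexed by points of `k`,
  -- and their values away from this image play no role.
  obtain ⟨ψ, -, hψ⟩ := exists_equiv_subspaces ((Finset.Ico M N).image pt) ∅ (by simp)
    (fun c => U (Function.invFun pt c)) (fun c => U' (Function.invFun pt c)) (fun c => h _)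
  refine ⟨ψ, fun i v => ?_⟩
  by_cases hi : i ∈ Finset.Ico M N
  · have := hψ (pt i) (Finset.mem_image_of_mem _ hi) v
    rwa [Function.leftInverse_invFun hpt i] at this
  · rw [Finset.mem_Ico, not_and_or, not_le, not_lt] at hi
    rcases hi with hi | hi
    · have h' : U' i = ⊥ := by
        have := h i
        rw [hM i hi, finrank_bot] at this
        exact Submodule.finrank_eq_zero.1 this.symm
      rw [hM i hi, h', Submodule.mem_bot, Submodule.mem_bot, vecEval_equiv_eq_zero_iff]
    · have h' : U' i = ⊤ := by
        have := h i
        rw [hN i hi] at this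
        exact Submodule.eq_top_of_finrank_eq (this.symm.trans (finrank_top _ _))
      rw [hN i hi, h']
      simp

/-- An increasing chain of lattices in `k[X]^r` whose steps are killed by linear polynomials with
distinct roots is determined by its images in the fibres at these roots. -/
theorem mem_chain_iff [CharZero k] (Λ : ℤ → Submodule k[X] (Fin r → k[X]))
    (hmono : ∀ j, Λ j ≤ Λ (j + 1))
    (hsmul : ∀ j, ∀ v ∈ Λ (j + 1), (X + C ((j : k) + 1)) • v ∈ Λ j)
    {N : ℤ} (htop : ∀ j, N ≤ j → Λ j = ⊤) (j : ℤ) (v : Fin r → k[X]) :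
    v ∈ Λ j ↔ ∀ i, j ≤ i →
      vecEval (-(i : k) - 1) v ∈ ((Λ i).restrictScalars k).map (vecEval (-(i : k) - 1)) := by
  have hle : ∀ i j, i ≤ j → Λ i ≤ Λ j := fun i j hij => by
    induction j, hij using Int.leInduction with
    | base => exact le_rfl
    | succ j _ ih => exact ih.trans (hmono j)
  refine ⟨fun hv i hi => ⟨v, hle _ _ hi hv, rfl⟩, fun hv => ?_⟩
  rcases le_total N j with hj | hj
  · rw [htop j hj]
    trivial
  induction j, hj using Int.leInductionDown generalizing v with
  | base => rw [htop N le_rfl]; trivial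
  | pred j hj ih =>
    have hv' : v ∈ Λ j := ih v fun i hi => hv i (by omega)
    -- Subtract an element of `Λ (j - 1)` with the same value at `-j`, so that `v - w = (X + j) u`.
    -- The factor `X + j` is a nonzero scalar at the points `-i - 1` with `i ≥ j`, so `u` inherits
    -- the fibre conditions and lies in `Λ j`; multiplying back by `X + j` lands in `Λ (j - 1)`.
    obtain ⟨w, hw, hwv⟩ := hv (j - 1) le_rfl
    have hw' : w ∈ Λ j := hle _ _ (by omega) hw
    obtain ⟨u, hu⟩ := exists_of_vecEval_eq_zero (c := -((j - 1 : ℤ) : k) - 1) (v := v - w)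
      (by rw [map_sub, ← hwv, sub_self])
    have huj : u ∈ Λ j := by
      refine ih u fun i hi => ?_
      obtain ⟨z, hz, hzu⟩ : vecEval (-(i : k) - 1) (v - w) ∈
          ((Λ i).restrictScalars k).map (vecEval (-(i : k) - 1)) :=
        ⟨v - w, hle _ _ hi ((Λ j).sub_mem hv' hw'), rfl⟩
      rw [hu, vecEval_smul] at hzu
      have hne : (X - C (-((j - 1 : ℤ) : k) - 1)).eval (-(i : k) - 1) ≠ 0 := by
        have : ((j - 1 - i : ℤ) : k) ≠ 0 := by
          rw [Int.cast_ne_zero]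
          omega
        convert this using 1
        push_cast
        simp
        ring
      rw [← Submodule.smul_mem_iff _ hne, ← hzu]
      exact ⟨z, hz, rfl⟩
    have := hsmul (j - 1) u (by simpa using huj)
    have he : X + C (((j - 1 : ℤ) : k) + 1) = X - C (-((j - 1 : ℤ) : k) - 1) := by
      simp only [C_sub, C_neg, C_add]
      ring
    rw [he, ← hu] at this
    simpa using (Λ (j - 1)).add_mem this hw

/-- Every value at one of the integral points is taken by a vector that vanishes at finitely many
other ones. -/
theorem exists_vecEval_eq [CharZero k] (S : Finset ℤ) {j : ℤ} (hj : j ∉ S) (w : Fin r → k) :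
    ∃ v : Fin r → k[X], vecEval (-(j : k) - 1) v = w ∧
      ∀ i ∈ S, vecEval (-(i : k) - 1) v = 0 := by
  let q : k[X] := ∏ i ∈ S, (X - C (-(i : k) - 1))
  have hq : q.eval (-(j : k) - 1) ≠ 0 := by
    rw [eval_prod, Finset.prod_ne_zero_iff]
    intro i hi h
    simp only [eval_sub, eval_X, eval_C, sub_sub_sub_cancel_right, sub_neg_eq_add] at h
    have : (i : k) = j := by linear_combination h
    exact hj (Int.cast_injective this ▸ hi)
  refine ⟨q • vecConst ((q.eval (-(j : k) - 1))⁻¹ • w), ?_, fun i hi => ?_⟩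
  · rw [vecEval_smul, vecEval_vecConst, smul_inv_smul₀ hq]
  · have : q.eval (-(i : k) - 1) = 0 := by
      rw [eval_prod]
      exact Finset.prod_eq_zero hi (by simp)
    rw [vecEval_smul, this, zero_smul]

end Lattices

/-! ### The homogeneous elements of the Weyl algebra -/

namespace Weyl

open Polynomial

section Monomials

variable (k : Type u) [CommRing k]

/-- The Euler element `yx`. -/
noncomputable def theta : Weyl k := gen k .y * gen k .x

/-- The monomial `x ^ n` or `y ^ (-n)` of degree `n`. -/
noncomputable def mon (n : ℤ) : Weyl k := gen k .x ^ n.toNat * gen k .y ^ (-n).toNat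

theorem mon_natCast (n : ℕ) : mon k n = gen k .x ^ n := by simp [mon]

theorem mon_neg_natCast (n : ℕ) : mon k (-n) = gen k .y ^ n := by simp [mon]

theorem x_mul_theta : gen k .x * theta k = (theta k + 1) * gen k .x := by
  rw [theta, ← mul_assoc, gen_rel]

theorem theta_mul_y : theta k * gen k .y = gen k .y * (theta k + 1) := by
  rw [theta, mul_assoc, gen_rel]

theorem x_mul_y : gen k .x * gen k .y = theta k + 1 := gen_rel k

end Monomials

section

variable {k : Type u} [CommRing k]

theorem mul_aeval_of_mul_eq {a s t : Weyl k} (h : a * s = t * a) (p : k[X]) :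
    a * aeval s p = aeval t p * a := by
  induction p using Polynomial.induction_on' with
  | add p q hp hq => rw [map_add, map_add, mul_add, add_mul, hp, hq]
  | monomial n c =>
    have : a * s ^ n = t ^ n * a := (show SemiconjBy a s t from h).pow_right n
    rw [aeval_monomial, aeval_monomial, ← mul_assoc, ← Algebra.commutes, mul_assoc, this,
      mul_assoc]

theorem aeval_theta_add (p : k[X]) (c : k) :
    aeval (theta k + algebraMap k _ c) p = aeval (theta k) (p.comp (X + C c)) := by
  rw [aeval_comp]
  simp

theorem x_mul_aeval (p : k[X]) :
    gen k .x * aeval (theta k) p = aeval (theta k) (p.comp (X + C 1)) * gen k .x := by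
  rw [← aeval_theta_add, map_one, mul_aeval_of_mul_eq (x_mul_theta k)]

theorem aeval_mul_y (p : k[X]) :
    aeval (theta k) p * gen k .y = gen k .y * aeval (theta k) (p.comp (X + C 1)) := by
  rw [← aeval_theta_add, map_one, mul_aeval_of_mul_eq (theta_mul_y k).symm]

theorem aeval_mul_x (p : k[X]) :
    aeval (theta k) p * gen k .x = gen k .x * aeval (theta k) (p.comp (X + C (-1))) := by
  rw [x_mul_aeval, comp_assoc]
  simp

theorem y_mul_aeval (p : k[X]) :
    gen k .y * aeval (theta k) p = aeval (theta k) (p.comp (X + C (-1))) * gen k .y := by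
  rw [aeval_mul_y, comp_assoc]
  simp

theorem exists_aeval_mul_x_pow (n : ℕ) (p : k[X]) :
    ∃ q : k[X], aeval (theta k) p * gen k .x ^ n = gen k .x ^ n * aeval (theta k) q := by
  induction n with
  | zero => exact ⟨p, by simp⟩
  | succ n ih =>
    obtain ⟨q, hq⟩ := ih
    exact ⟨_, by rw [pow_succ, ← mul_assoc, hq, mul_assoc, aeval_mul_x, ← mul_assoc]⟩

theorem exists_aeval_mul_y_pow (n : ℕ) (p : k[X]) :
    ∃ q : k[X], aeval (theta k) p * gen k .y ^ n = gen k .y ^ n * aeval (theta k) q := by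
  induction n with
  | zero => exact ⟨p, by simp⟩
  | succ n ih =>
    obtain ⟨q, hq⟩ := ih
    exact ⟨_, by rw [pow_succ, ← mul_assoc, hq, mul_assoc, aeval_mul_y, ← mul_assoc]⟩

/-- If the new letter is opposite to those of the monomial, a factor `yx = θ` or `xy = θ + 1`
appears, and it is pushed to the right through the remaining power. Otherwise the power just grows.
-/
theorem exists_gen_mul_mon (g : WeylGen) (n : ℤ) :
    ∃ q : k[X], gen k g * mon k n = mon k (genDeg g + n) * aeval (theta k) q := by
  obtain ⟨m, rfl | rfl⟩ := n.eq_nat_or_neg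
  · cases g with
    | x =>
      refine ⟨1, ?_⟩
      rw [show genDeg .x + (m : ℤ) = (m + 1 : ℕ) by simp [genDeg, add_comm], mon_natCast,
        mon_natCast, map_one, mul_one, pow_succ']
    | y =>
      cases m with
      | zero =>
        refine ⟨1, ?_⟩
        have := mon_neg_natCast k 1
        have h0 := mon_natCast k 0
        simp only [Nat.cast_zero, pow_zero, Nat.cast_one, pow_one] at this h0
        simp [genDeg, this, h0]
      | succ m =>
        obtain ⟨q, hq⟩ := exists_aeval_mul_x_pow m (X : k[X])
        refine ⟨q, ?_⟩
        rw [show genDeg .y + ((m + 1 : ℕ) : ℤ) = m by simp [genDeg], mon_natCast, mon_natCast,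
          ← hq, aeval_X, pow_succ', ← mul_assoc, theta]
  · cases g with
    | y =>
      refine ⟨1, ?_⟩
      rw [show genDeg .y + -(m : ℤ) = -(m + 1 : ℕ) by simp [genDeg], mon_neg_natCast,
        mon_neg_natCast, map_one, mul_one, pow_succ']
    | x =>
      cases m with
      | zero =>
        refine ⟨1, ?_⟩
        have := mon_natCast k 1
        have h0 := mon_natCast k 0
        simp only [Nat.cast_zero, pow_zero, Nat.cast_one, pow_one] at this h0
        simp [genDeg, this, h0]
      | succ m =>
        obtain ⟨q, hq⟩ := exists_aeval_mul_y_pow m (X + 1 : k[X])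
        refine ⟨q, ?_⟩
        rw [show genDeg .x + -((m + 1 : ℕ) : ℤ) = -m by simp [genDeg], mon_neg_natCast,
          mon_neg_natCast, ← hq, map_add, map_one, aeval_X, ← x_mul_y, pow_succ', ← mul_assoc]

/-- Words are absorbed letter by letter from the right end. Each graded piece is thus cyclic over
`k[X]`, which reduces questions on homogeneous elements to polynomials. -/
theorem exists_eq_mon_mul {n : ℤ} {a : Weyl k} (ha : a ∈ grading k n) :
    ∃ q : k[X], a = mon k n * aeval (theta k) q := by
  induction ha using Submodule.span_induction with
  | mem a h =>
    obtain ⟨w, rfl, rfl⟩ := h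
    induction w with
    | nil => exact ⟨1, by simp [mon]⟩
    | cons g w ih =>
      obtain ⟨q, hq⟩ := ih
      obtain ⟨q', hq'⟩ := exists_gen_mul_mon (k := k) g (w.map genDeg).sum
      refine ⟨q' * q, ?_⟩
      rw [List.map_cons, List.prod_cons, hq, ← mul_assoc, hq', List.map_cons, List.sum_cons,
        map_mul, mul_assoc]
  | zero => exact ⟨0, by simp⟩
  | add a b _ _ iha ihb =>
    obtain ⟨p, rfl⟩ := iha
    obtain ⟨q, rfl⟩ := ihb
    exact ⟨p + q, by rw [map_add, mul_add]⟩
  | smul c a _ ih =>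
    obtain ⟨p, rfl⟩ := ih
    exact ⟨c • p, by rw [map_smul, mul_smul_comm]⟩

theorem x_mem : gen k .x ∈ grading k 1 := gen_mem k .x

theorem y_mem : gen k .y ∈ grading k (-1) := gen_mem k .y

theorem algebraMap_mem (c : k) : algebraMap k (Weyl k) c ∈ grading k 0 :=
  SetLike.algebraMap_mem_graded (grading k) c

theorem theta_mem : theta k ∈ grading k 0 := by
  have := SetLike.mul_mem_graded (y_mem (k := k)) x_mem
  rwa [neg_add_cancel] at this

theorem aeval_mem (p : k[X]) : aeval (theta k) p ∈ grading k 0 := by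
  induction p using Polynomial.induction_on' with
  | add p q hp hq => rw [map_add]; exact add_mem hp hq
  | monomial n c =>
    rw [aeval_monomial]
    have h1 : theta k ^ n ∈ grading k 0 := by
      have := SetLike.pow_mem_graded n (theta_mem (k := k))
      rwa [smul_zero] at this
    have := SetLike.mul_mem_graded (algebraMap_mem c) h1
    rwa [add_zero] at this

theorem x_pow_mem (n : ℕ) : gen k .x ^ n ∈ grading k n := by
  have := SetLike.pow_mem_graded n (x_mem (k := k))
  simpa using this

theorem y_pow_mem (n : ℕ) : gen k .y ^ n ∈ grading k (-n) := by
  have := SetLike.pow_mem_graded n (y_mem (k := k))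
  simpa using this

theorem mon_mem (n : ℤ) : mon k n ∈ grading k n := by
  obtain ⟨m, rfl | rfl⟩ := n.eq_nat_or_neg
  · rw [mon_natCast]; exact x_pow_mem m
  · rw [mon_neg_natCast]; exact y_pow_mem m

/-- In positive degree the monomial ends in a letter `x`, which moves past a polynomial in `θ` at
the cost of shifting its variable. -/
theorem exists_mul_x_eq {n : ℤ} (hn : 0 ≤ n) {a : Weyl k} (ha : a ∈ grading k (n + 1)) :
    ∃ b ∈ grading k n, b * gen k .x = a := by
  obtain ⟨m, rfl⟩ := Int.eq_ofNat_of_zero_le hn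
  obtain ⟨q, rfl⟩ := exists_eq_mon_mul ha
  refine ⟨gen k .x ^ m * aeval (theta k) (q.comp (X + C 1)), ?_, ?_⟩
  · have := SetLike.mul_mem_graded (x_pow_mem m) (aeval_mem (q.comp (X + C 1)))
    rwa [add_zero] at this
  · rw [mul_assoc, ← x_mul_aeval, ← mul_assoc, ← pow_succ, ← mon_natCast, Nat.cast_succ]

theorem exists_mul_y_eq {n : ℤ} (hn : n ≤ 0) {a : Weyl k} (ha : a ∈ grading k (n - 1)) :
    ∃ b ∈ grading k n, b * gen k .y = a := by
  obtain ⟨m, rfl⟩ := Int.exists_eq_neg_ofNat hn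
  obtain ⟨q, rfl⟩ := exists_eq_mon_mul ha
  refine ⟨gen k .y ^ m * aeval (theta k) (q.comp (X + C (-1))), ?_, ?_⟩
  · have := SetLike.mul_mem_graded (y_pow_mem m) (aeval_mem (q.comp (X + C (-1))))
    rwa [add_zero] at this
  · rw [mul_assoc, ← y_mul_aeval, ← mul_assoc, ← pow_succ, ← mon_neg_natCast]
    congr 2
    push_cast
    ring

/-! ### The representation by differential operators on `k[X]` -/

variable (k) in
/-- The action of the Weyl algebra on polynomials by differential operators. -/
noncomputable def diffOp : Weyl k →ₐ[k] Module.End k k[X] :=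
  RingQuot.liftAlgHom k ⟨FreeAlgebra.lift k fun g => match g with
    | .x => derivative
    | .y => LinearMap.mulLeft k X, by
    rintro _ _ ⟨⟩
    refine LinearMap.ext fun p => ?_
    simp [FreeAlgebra.lift_ι_apply, add_comm]⟩

theorem diffOp_x (p : k[X]) : diffOp k (gen k .x) p = derivative p := by
  simp [diffOp, gen]

theorem diffOp_y (p : k[X]) : diffOp k (gen k .y) p = X * p := by
  simp [diffOp, gen]

theorem diffOp_x_pow (n : ℕ) (p : k[X]) : diffOp k (gen k .x ^ n) p = derivative^[n] p := by
  have : diffOp k (gen k .x) = derivative := LinearMap.ext diffOp_x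
  rw [map_pow, this, Module.End.pow_apply]

theorem diffOp_y_pow (n : ℕ) (p : k[X]) : diffOp k (gen k .y ^ n) p = X ^ n * p := by
  induction n with
  | zero => simp
  | succ n ih => rw [pow_succ', map_mul, Module.End.mul_apply, ih, diffOp_y, pow_succ', mul_assoc]

/-- `yx` acts as the Euler operator, for which `X ^ n` is an eigenvector of eigenvalue `n`. -/
theorem diffOp_aeval (p : k[X]) (n : ℕ) :
    diffOp k (aeval (theta k) p) (X ^ n) = C (p.eval (n : k)) * X ^ n := by
  have h1 : diffOp k (theta k) (X ^ n) = (n : k) • (X ^ n : k[X]) := by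
    rw [theta, map_mul, Module.End.mul_apply, diffOp_x, diffOp_y, derivative_X_pow, smul_eq_C_mul]
    cases n with
    | zero => simp
    | succ n => rw [Nat.add_sub_cancel, pow_succ]; ring
  induction p using Polynomial.induction_on' with
  | add p q hp hq => rw [map_add, map_add, LinearMap.add_apply, hp, hq, eval_add, C_add, add_mul]
  | monomial m c =>
    have h2 : diffOp k (theta k ^ m) (X ^ n) = (n : k) ^ m • (X ^ n : k[X]) := by
      induction m with
      | zero => simp
      | succ m ih =>
        rw [pow_succ, map_mul, Module.End.mul_apply, h1, map_smul, ih, smul_smul, pow_succ']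
    rw [aeval_monomial, ← Algebra.smul_def, map_smul, LinearMap.smul_apply, h2, smul_smul,
      eval_monomial, smul_eq_C_mul]

end

section

variable {k : Type u} [Field k]

/-- Homogeneous elements have no torsion for the right multiplication by polynomials in `yx`. -/
theorem eq_zero_of_mul_aeval_eq_zero [CharZero k] {n : ℤ} {a : Weyl k} (ha : a ∈ grading k n)
    {p : k[X]} (hp : p ≠ 0) (h : a * aeval (theta k) p = 0) : a = 0 := by
  obtain ⟨q, rfl⟩ := exists_eq_mon_mul ha
  rw [mul_assoc, ← map_mul] at h
  suffices hqp : q * p = 0 by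
    rw [(mul_eq_zero.1 hqp).resolve_right hp, map_zero, mul_zero]
  -- Applied to `X ^ i` with `i` large, the operator gives `(q * p)(i)` times a nonzero multiple of
  -- a power of `X`. So `q * p` has infinitely many roots; characteristic `0` keeps the descending
  -- factorials nonzero and the naturals distinct.
  have key : ∃ m : ℕ, ∀ i : ℕ, m ≤ i → (q * p).eval (i : k) = 0 := by
    obtain ⟨m, rfl | rfl⟩ := n.eq_nat_or_neg
    · refine ⟨m, fun i hi => ?_⟩
      have h1 := congrArg (fun b => diffOp k b (X ^ i)) h
      simp only [mon_natCast] at h1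
      rw [map_mul, Module.End.mul_apply, diffOp_aeval, diffOp_x_pow, iterate_derivative_C_mul,
        iterate_derivative_X_pow_eq_C_mul, map_zero, LinearMap.zero_apply] at h1
      rw [mul_eq_zero, mul_eq_zero] at h1
      rcases h1 with h1 | h1 | h1
      · exact C_eq_zero.1 h1
      · rw [C_eq_zero, Nat.cast_eq_zero, Nat.descFactorial_eq_zero_iff_lt] at h1
        omega
      · exact absurd h1 (pow_ne_zero _ X_ne_zero)
    · refine ⟨0, fun i _ => ?_⟩
      have h1 := congrArg (fun b => diffOp k b (X ^ i)) h
      simp only [mon_neg_natCast] at h1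
      rw [map_mul, Module.End.mul_apply, diffOp_aeval, diffOp_y_pow, map_zero,
        LinearMap.zero_apply] at h1
      simpa using h1
  obtain ⟨m, hm⟩ := key
  refine eq_zero_of_infinite_isRoot _ (Set.Infinite.mono ?_
    ((Set.Ici_infinite m).image (Nat.cast_injective (R := k)).injOn))
  rintro _ ⟨i, hi, rfl⟩
  exact hm i hi

/-- The functional `a ↦ a₀`, where `a = y ^ m a₀ + y ^ (m + 1) a₁ x` has degree `-m`. -/
noncomputable def lead (k : Type u) [Field k] (m : ℕ) : Weyl k →ₗ[k] k :=
  lcoeff k m ∘ₗ LinearMap.applyₗ (1 : k[X]) ∘ₗ (diffOp k).toLinearMap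

theorem lead_apply (m : ℕ) (a : Weyl k) : lead k m a = (diffOp k a 1).coeff m := rfl

theorem lead_y_pow (m : ℕ) : lead k m (gen k .y ^ m) = 1 := by
  rw [lead_apply, diffOp_y_pow, mul_one, coeff_X_pow_self]

theorem lead_mul_x (m : ℕ) (b : Weyl k) : lead k m (b * gen k .x) = 0 := by
  rw [lead_apply, map_mul, Module.End.mul_apply, diffOp_x]
  simp

/-- Writing `a = y ^ m q(θ)`, the operator sends `1` to `q(0) X ^ m`. If `q(0) = 0`, a factor `θ =
yx` splits off `q`, and its `x` can be moved to the far right. -/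
theorem lead_eq_zero_iff {m : ℕ} {a : Weyl k} (ha : a ∈ grading k (-m)) :
    lead k m a = 0 ↔ ∃ b ∈ grading k (-m - 1), b * gen k .x = a := by
  refine ⟨fun h => ?_, ?_⟩
  · obtain ⟨q, rfl⟩ := exists_eq_mon_mul ha
    have h0 : q.eval 0 = 0 := by
      have h1 : diffOp k (aeval (theta k) q) 1 = C (q.eval 0) := by
        simpa using diffOp_aeval q 0
      rw [lead_apply, mon_neg_natCast, map_mul, Module.End.mul_apply, h1, diffOp_y_pow] at h
      simpa using h
    obtain ⟨p, rfl⟩ := X_dvd_iff.2 (by rwa [← coeff_zero_eq_eval_zero] at h0)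
    refine ⟨gen k .y ^ (m + 1) * aeval (theta k) (p.comp (X + C 1)), ?_, ?_⟩
    · have := SetLike.mul_mem_graded (y_pow_mem (m + 1)) (aeval_mem (p.comp (X + C 1)))
      rw [add_zero] at this
      convert this using 2
      push_cast
      ring
    · rw [mul_assoc, ← x_mul_aeval, map_mul, aeval_X, mon_neg_natCast, theta, pow_succ]
      simp only [mul_assoc]
  · rintro ⟨b, -, rfl⟩
    exact lead_mul_x m b

end

end Weyl

/-! ### Graded free covers -/

namespace GrMod

variable {k R : Type u} [CommRing k] [Ring R] [Algebra k R] {𝒜 : ℤ → Submodule k R}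

/-- Finite direct sums of shifts of the free module of rank one. -/
inductive IsGrFree [GradedAlgebra 𝒜] : GrMod 𝒜 → Prop
  | zero : IsGrFree (zero 𝒜)
  | free (n : ℤ) : IsGrFree ((self 𝒜).shift n)
  | sum {F G : GrMod 𝒜} : IsGrFree F → IsGrFree G → IsGrFree (F.sum G)

/-- A degree-preserving map commutes with the projections to components, so the degree `n` part of
any preimage is again a preimage. -/
theorem exists_mem_deg_of_surjective {M N : GrMod 𝒜} (g : GrHom M N)
    (hg : Function.Surjective g.toLinearMap) {n : ℤ} {p : N.carrier} (hp : p ∈ N.deg n) :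
    ∃ m ∈ M.deg n, g.toLinearMap m = p := by
  let _ := M.isInternal.chooseDecomposition
  let _ := N.isInternal.chooseDecomposition
  have key : ∀ m : M.carrier, g.toLinearMap (DirectSum.decompose M.deg m n : M.carrier) =
      (DirectSum.decompose N.deg (g.toLinearMap m) n : N.carrier) := by
    intro m
    induction m using DirectSum.Decomposition.inductionOn M.deg with
    | zero => simp
    | @homogeneous i m =>
      by_cases hi : i = n
      · subst hi
        rw [DirectSum.decompose_of_mem_same _ m.2,
          DirectSum.decompose_of_mem_same _ (g.map_deg _ _ m.2)]
      · rw [DirectSum.decompose_of_mem_ne _ m.2 hi,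
          DirectSum.decompose_of_mem_ne _ (g.map_deg _ _ m.2) hi, map_zero]
    | add m m' h h' => simp [h, h']
  obtain ⟨m, rfl⟩ := hg p
  exact ⟨_, (DirectSum.decompose M.deg m n).2, by
    rw [key, DirectSum.decompose_of_mem_same _ hp]⟩

theorem induction_on_homogeneous {M : GrMod 𝒜} {Q : M.carrier → Prop} (h0 : Q 0)
    (hh : ∀ i, ∀ m ∈ M.deg i, Q m) (hadd : ∀ m m', Q m → Q m' → Q (m + m')) (m : M.carrier) :
    Q m := by
  let _ := M.isInternal.chooseDecomposition
  exact DirectSum.Decomposition.inductionOn M.deg h0 (fun m => hh _ _ m.2) hadd m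

/-- The morphism from a shift of the free module of rank one with a given value at `1`. -/
theorem exists_hom_free [GradedAlgebra 𝒜] {P : GrMod 𝒜} {n : ℤ} {p : P.carrier}
    (hp : p ∈ P.deg n) : ∃ g : GrHom ((self 𝒜).shift n) P, g.toLinearMap (1 : R) = p := by
  let φ : R →ₗ[Rᵐᵒᵖ] P.carrier :=
    { toFun := fun r => op r • p
      map_add' := fun r s => by rw [op_add, add_smul]
      map_smul' := fun a r => by
        rw [RingHom.id_apply, ← mul_smul]
        rfl }
  refine ⟨⟨φ, fun i r hr => ?_⟩, ?_⟩
  · have := P.smul_mem (i := i - n) (r := r) hr hp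
    rwa [add_sub_cancel] at this
  · change op (1 : R) • p = p
    rw [op_one, one_smul]

/-- The morphism out of a direct sum with given components. -/
def homCoprod {F G P : GrMod 𝒜} (f : GrHom F P) (g : GrHom G P) : GrHom (F.sum G) P :=
  ⟨LinearMap.coprod f.toLinearMap g.toLinearMap, fun i _ hm =>
    (P.deg i).add_mem (f.map_deg i _ hm.1) (g.map_deg i _ hm.2)⟩

theorem homCoprod_apply {F G P : GrMod 𝒜} (f : GrHom F P) (g : GrHom G P) (m : F.carrier)
    (m' : G.carrier) :
    (homCoprod f g).toLinearMap ((m, m') : F.carrier × G.carrier) =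
      f.toLinearMap m + g.toLinearMap m' := rfl

theorem exists_isGrFree_mem_range [GradedAlgebra 𝒜] {P : GrMod 𝒜} (p : P.carrier) :
    ∃ F, IsGrFree F ∧ ∃ (g : GrHom F P) (m : F.carrier), g.toLinearMap m = p := by
  induction p using induction_on_homogeneous with
  | h0 => exact ⟨_, .zero, ⟨0, fun i _ _ => (P.deg i).zero_mem⟩, 0, rfl⟩
  | hh i p hp =>
    obtain ⟨g, hg⟩ := exists_hom_free hp
    exact ⟨_, .free i, g, _, hg⟩
  | hadd p p' h h' =>
    obtain ⟨F, hF, f, m, rfl⟩ := h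
    obtain ⟨G, hG, g, m', rfl⟩ := h'
    exact ⟨_, .sum hF hG, homCoprod f g, (m, m'), rfl⟩

/-- A finitely generated graded module is a quotient of a finite graded free module. -/
theorem exists_isGrFree_surjective [GradedAlgebra 𝒜] {P : GrMod 𝒜} (hP : P.IsFG) :
    ∃ F, IsGrFree F ∧ ∃ g : GrHom F P, Function.Surjective g.toLinearMap := by
  classical
  obtain ⟨S, hS⟩ := hP.fg_top
  suffices ∃ F, IsGrFree F ∧ ∃ g : GrHom F P, ∀ s ∈ S, s ∈ LinearMap.range g.toLinearMap by
    obtain ⟨F, hF, g, hg⟩ := this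
    refine ⟨F, hF, g, LinearMap.range_eq_top.1 (eq_top_iff.2 ?_)⟩
    rw [← hS, Submodule.span_le]
    exact hg
  clear hS
  induction S using Finset.induction_on with
  | empty => exact ⟨_, .zero, ⟨0, fun i _ _ => (P.deg i).zero_mem⟩, by simp⟩
  | insert a S _ ih =>
    obtain ⟨F, hF, f, hf⟩ := ih
    obtain ⟨G, hG, g, m, rfl⟩ := exists_isGrFree_mem_range a
    refine ⟨_, .sum hF hG, homCoprod f g, fun s hs => ?_⟩
    rcases Finset.mem_insert.1 hs with rfl | hs
    · exact ⟨(0, m), by rw [homCoprod_apply, map_zero, zero_add]⟩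
    · obtain ⟨m', rfl⟩ := hf s hs
      exact ⟨(m', 0), by rw [homCoprod_apply, map_zero, add_zero]⟩

/-- Every surjection onto a graded projective module splits. -/
theorem IsProjective.exists_section {P F : GrMod 𝒜} (hP : P.IsProjective) (g : GrHom F P)
    (hg : Function.Surjective g.toLinearMap) :
    ∃ s : GrHom P F, ∀ p, g.toLinearMap (s.toLinearMap p) = p := by
  obtain ⟨s, hs⟩ := hP F P g ⟨LinearMap.id, fun _ _ h => h⟩ hg
  exact ⟨s, fun p => LinearMap.congr_fun hs p⟩

end GrMod

/-! ### Graded modules over the Weyl algebra as graded modules over polynomials -/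

namespace Weyl

open Polynomial GrMod

section

variable {k : Type u} [CommRing k]

instance moduleBase (P : GrMod (grading k)) : Module k P.carrier :=
  Module.compHom P.carrier (algebraMap k (Weyl k)ᵐᵒᵖ)

/-- Polynomials act on graded modules through `X ↦ yx`. -/
noncomputable instance modulePoly (P : GrMod (grading k)) : Module k[X] P.carrier :=
  Module.compHom P.carrier ((aeval (theta k)).toRingHom.toOpposite fun p q => by
    change aeval (theta k) p * aeval (theta k) q = aeval (theta k) q * aeval (theta k) p
    rw [← map_mul, mul_comm, map_mul])

variable {P Q : GrMod (grading k)}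

theorem base_smul_def (c : k) (p : P.carrier) : c • p = op (algebraMap k (Weyl k) c) • p := rfl

theorem poly_smul_def (f : k[X]) (p : P.carrier) : f • p = op (aeval (theta k) f) • p := rfl

instance : IsScalarTower k k[X] P.carrier :=
  ⟨fun c f p => by
    rw [poly_smul_def, poly_smul_def, base_smul_def, ← mul_smul, ← op_mul, map_smul,
      Algebra.smul_def, Algebra.commutes]⟩

theorem op_smul_base_smul (a : Weyl k) (c : k) (p : P.carrier) : op a • c • p = c • op a • p := by
  rw [base_smul_def, base_smul_def, ← mul_smul, ← mul_smul, ← op_mul, ← op_mul, Algebra.commutes]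

theorem x_smul_poly (f : k[X]) (p : P.carrier) :
    op (gen k .x) • f • p = f.comp (X + C (-1)) • op (gen k .x) • p := by
  rw [poly_smul_def, poly_smul_def, ← mul_smul, ← mul_smul, ← op_mul, ← op_mul, aeval_mul_x]

theorem x_smul_y_smul (p : P.carrier) : op (gen k .x) • op (gen k .y) • p = (X : k[X]) • p := by
  rw [poly_smul_def, ← mul_smul, ← op_mul, aeval_X]
  rfl

theorem y_smul_x_smul (p : P.carrier) :
    op (gen k .y) • op (gen k .x) • p = (X + 1 : k[X]) • p := by
  rw [poly_smul_def, ← mul_smul, ← op_mul, map_add, map_one, aeval_X, x_mul_y]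

theorem x_smul_mem {j : ℤ} {p : P.carrier} (hp : p ∈ P.deg j) :
    op (gen k .x) • p ∈ P.deg (j + 1) := P.smul_mem x_mem hp

theorem y_smul_mem {j : ℤ} {p : P.carrier} (hp : p ∈ P.deg j) :
    op (gen k .y) • p ∈ P.deg (j - 1) := P.smul_mem y_mem hp

theorem base_smul_mem {j : ℤ} {p : P.carrier} (c : k) (hp : p ∈ P.deg j) : c • p ∈ P.deg j := by
  have := P.smul_mem (algebraMap_mem c) hp
  rwa [add_zero] at this

variable (P) in
/-- The homogeneous component of degree `j`, as a module over the polynomials. -/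
noncomputable def component (j : ℤ) : Submodule k[X] P.carrier :=
  { P.deg j with
    smul_mem' := fun f p hp => by
      have := P.smul_mem (aeval_mem f) hp
      rwa [add_zero] at this }

variable (P) in
/-- Right multiplication by `x`. -/
noncomputable def xMul : P.carrier →ₗ[k] P.carrier where
  toFun p := op (gen k .x) • p
  map_add' := smul_add _
  map_smul' c p := op_smul_base_smul _ c p

theorem xMul_apply (p : P.carrier) : xMul P p = op (gen k .x) • p := rfl

/-- The map over polynomials underlying a morphism of graded modules. -/
noncomputable def polyMap (g : GrHom P Q) : P.carrier →ₗ[k[X]] Q.carrier where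
  toFun := g.toLinearMap
  map_add' := map_add _
  map_smul' _ _ := map_smul g.toLinearMap _ _

theorem polyMap_apply (g : GrHom P Q) (p : P.carrier) : polyMap g p = g.toLinearMap p := rfl

/-! ### Properties transferred from free covers -/

/-- Right multiplication by `x` is surjective in degrees at least `N`. -/
def XSurjFrom (P : GrMod (grading k)) (N : ℤ) : Prop :=
  ∀ j, N ≤ j → ∀ p ∈ P.deg (j + 1), ∃ q ∈ P.deg j, op (gen k .x) • q = p

/-- Right multiplication by `y` is surjective in degrees at most `M`. -/
def YSurjTo (P : GrMod (grading k)) (M : ℤ) : Prop :=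
  ∀ j, j ≤ M → ∀ p ∈ P.deg (j - 1), ∃ q ∈ P.deg j, op (gen k .y) • q = p

theorem XSurjFrom.of_surjective {N : ℤ} (h : XSurjFrom P N) (g : GrHom P Q)
    (hg : Function.Surjective g.toLinearMap) : XSurjFrom Q N := by
  intro j hj p hp
  obtain ⟨m, hm, rfl⟩ := exists_mem_deg_of_surjective g hg hp
  obtain ⟨q, hq, rfl⟩ := h j hj m hm
  exact ⟨_, g.map_deg _ _ hq, (map_smul g.toLinearMap _ _).symm⟩

theorem YSurjTo.of_surjective {N : ℤ} (h : YSurjTo P N) (g : GrHom P Q)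
    (hg : Function.Surjective g.toLinearMap) : YSurjTo Q N := by
  intro j hj p hp
  obtain ⟨m, hm, rfl⟩ := exists_mem_deg_of_surjective g hg hp
  obtain ⟨q, hq, rfl⟩ := h j hj m hm
  exact ⟨_, g.map_deg _ _ hq, (map_smul g.toLinearMap _ _).symm⟩

theorem exists_xSurjFrom_of_isGrFree {F : GrMod (grading k)} (hF : F.IsGrFree) :
    ∃ N, XSurjFrom F N := by
  induction hF with
  | zero => exact ⟨0, fun j _ p hp => ⟨0, (GrMod.zero _).deg j |>.zero_mem, rfl⟩⟩
  | free n =>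
    refine ⟨n, fun j hj p hp => ?_⟩
    obtain ⟨b, hb, hbp⟩ := exists_mul_x_eq (k := k) (n := j - n) (by omega) (a := p) (by
      rw [sub_add_eq_add_sub]; exact hp)
    exact ⟨b, hb, hbp⟩
  | @sum F G _ _ ihF ihG =>
    obtain ⟨N, hN⟩ := ihF
    obtain ⟨N', hN'⟩ := ihG
    refine ⟨max N N', fun j hj p hp => ?_⟩
    obtain ⟨q, hq, hqp⟩ := hN j ((le_max_left _ _).trans hj) p.1 hp.1
    obtain ⟨q', hq', hqp'⟩ := hN' j ((le_max_right _ _).trans hj) p.2 hp.2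
    exact ⟨(q, q'), ⟨hq, hq'⟩, Prod.ext hqp hqp'⟩

theorem exists_ySurjTo_of_isGrFree {F : GrMod (grading k)} (hF : F.IsGrFree) :
    ∃ M, YSurjTo F M := by
  induction hF with
  | zero => exact ⟨0, fun j _ p hp => ⟨0, (GrMod.zero _).deg j |>.zero_mem, rfl⟩⟩
  | free n =>
    refine ⟨n, fun j hj p hp => ?_⟩
    obtain ⟨b, hb, hbp⟩ := exists_mul_y_eq (k := k) (n := j - n) (by omega) (a := p) (by
      rw [sub_right_comm]; exact hp)
    exact ⟨b, hb, hbp⟩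
  | @sum F G _ _ ihF ihG =>
    obtain ⟨N, hN⟩ := ihF
    obtain ⟨N', hN'⟩ := ihG
    refine ⟨min N N', fun j hj p hp => ?_⟩
    obtain ⟨q, hq, hqp⟩ := hN j (hj.trans (min_le_left _ _)) p.1 hp.1
    obtain ⟨q', hq', hqp'⟩ := hN' j (hj.trans (min_le_right _ _)) p.2 hp.2
    exact ⟨(q, q'), ⟨hq, hq'⟩, Prod.ext hqp hqp'⟩

theorem component_fg_of_surjective {j : ℤ} (h : (component P j).FG) (g : GrHom P Q)
    (hg : Function.Surjective g.toLinearMap) : (component Q j).FG := by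
  have : component Q j = (component P j).map (polyMap g) := by
    refine le_antisymm (fun p hp => ?_) ?_
    · obtain ⟨m, hm, rfl⟩ := exists_mem_deg_of_surjective g hg hp
      exact ⟨m, hm, rfl⟩
    · rintro _ ⟨m, hm, rfl⟩
      exact g.map_deg _ _ hm
  rw [this]
  exact h.map _

theorem component_fg_of_isGrFree {F : GrMod (grading k)} (hF : F.IsGrFree) (j : ℤ) :
    (component F j).FG := by
  induction hF with
  | zero =>
    have : component (GrMod.zero (grading k)) j = ⊥ := le_antisymm (fun p _ => rfl) bot_le
    rw [this]
    exact Submodule.fg_bot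
  | free n =>
    let c : ((self (grading k)).shift n).carrier := mon k (j - n)
    have : component ((self (grading k)).shift n) j = Submodule.span k[X] {c} := by
      refine le_antisymm (fun p hp => ?_) (Submodule.span_le.2 ?_)
      · obtain ⟨q, hq⟩ := exists_eq_mon_mul (k := k) (n := j - n) (a := p) hp
        exact Submodule.mem_span_singleton.2 ⟨q, hq.symm⟩
      · rw [Set.singleton_subset_iff]
        exact mon_mem (k := k) (j - n)
    rw [this]
    exact Submodule.fg_span_singleton _
  | @sum F G _ _ ihF ihG =>
    let inl : GrHom F (F.sum G) := ⟨LinearMap.inl _ F.carrier G.carrier,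
      fun i m hm => ⟨hm, (G.deg i).zero_mem⟩⟩
    let inr : GrHom G (F.sum G) := ⟨LinearMap.inr _ F.carrier G.carrier,
      fun i m hm => ⟨(F.deg i).zero_mem, hm⟩⟩
    have : component (F.sum G) j =
        (component F j).map (polyMap inl) ⊔ (component G j).map (polyMap inr) := by
      refine le_antisymm (fun p hp => ?_) (sup_le ?_ ?_)
      · exact Submodule.mem_sup.2 ⟨_, ⟨p.1, hp.1, rfl⟩, _, ⟨p.2, hp.2, rfl⟩,
          Prod.ext (add_zero p.1) (zero_add p.2)⟩
      · rintro _ ⟨m, hm, rfl⟩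
        exact inl.map_deg _ _ hm
      · rintro _ ⟨m, hm, rfl⟩
        exact inr.map_deg _ _ hm
    rw [this]
    exact (ihF.map _).sup (ihG.map _)

end

section

variable {k : Type u} [Field k] {P Q : GrMod (grading k)}

/-- The homogeneous components are torsion-free over the polynomials. -/
def HomogTorsionFree (P : GrMod (grading k)) : Prop :=
  ∀ j, ∀ p ∈ P.deg j, ∀ f : k[X], f ≠ 0 → f • p = 0 → p = 0

theorem HomogTorsionFree.of_injective (h : HomogTorsionFree Q) (g : GrHom P Q)
    (hg : Function.Injective g.toLinearMap) : HomogTorsionFree P := by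
  intro j p hp f hf hfp
  refine hg ((h j _ (g.map_deg _ _ hp) f hf ?_).trans (map_zero _).symm)
  rw [← polyMap_apply, ← map_smul, hfp, map_zero]

theorem homogTorsionFree_of_isGrFree [CharZero k] {F : GrMod (grading k)} (hF : F.IsGrFree) :
    HomogTorsionFree F := by
  induction hF with
  | zero => exact fun j p _ f _ _ => rfl
  | free n => exact fun j p hp f hf h => eq_zero_of_mul_aeval_eq_zero (k := k) hp hf h
  | @sum F G _ _ ihF ihG =>
    intro j p hp f hf h
    exact Prod.ext (ihF j p.1 hp.1 f hf (congrArg Prod.fst h))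
      (ihG j p.2 hp.2 f hf (congrArg Prod.snd h))

/-- Surjectivity and finite generation descend along a free cover `F → P`. Torsion-freeness comes
from a section `P → F`, and this is what projectivity is used for. -/
theorem exists_properties [CharZero k] (P : FGProj (grading k)) :
    (∃ N, XSurjFrom P.toGrMod N) ∧ (∃ M, YSurjTo P.toGrMod M) ∧
      (∀ j, (component P.toGrMod j).FG) ∧ HomogTorsionFree P.toGrMod := by
  obtain ⟨F, hF, g, hg⟩ := exists_isGrFree_surjective P.isFG
  obtain ⟨s, hs⟩ := P.isProjective.exists_section g hg
  obtain ⟨N, hN⟩ := exists_xSurjFrom_of_isGrFree hF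
  obtain ⟨M, hM⟩ := exists_ySurjTo_of_isGrFree hF
  exact ⟨⟨N, hN.of_surjective g hg⟩, ⟨M, hM.of_surjective g hg⟩,
    fun j => component_fg_of_surjective (component_fg_of_isGrFree hF j) g hg,
    (homogTorsionFree_of_isGrFree hF).of_injective s (Function.LeftInverse.injective hs)⟩

end

end Weyl

theorem GrMod.exists_addMonoidHom_of_deg {k R : Type u} [CommRing k] [Ring R] [Algebra k R]
    {𝒜 : ℤ → Submodule k R} (M : GrMod 𝒜) {G : Type*} [AddCommGroup G] (f : ∀ j, M.deg j →+ G) :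
    ∃ F : M.carrier →+ G, ∀ j p (hp : p ∈ M.deg j), F p = f j ⟨p, hp⟩ := by
  let _ := M.isInternal.chooseDecomposition
  refine ⟨(DirectSum.toAddMonoid f).comp (DirectSum.decomposeAddEquiv M.deg).toAddMonoidHom,
    fun j p hp => ?_⟩
  change DirectSum.toAddMonoid f (DirectSum.decompose M.deg p) = _
  rw [DirectSum.decompose_of_mem M.deg hp, DirectSum.toAddMonoid_of]

/-! ### Coordinates: graded modules as chains of lattices -/

namespace Weyl

open Polynomial GrMod

variable {k : Type u} [Field k] {P Q : GrMod (grading k)}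

theorem xMul_pow_mem {j : ℤ} {p : P.carrier} (hp : p ∈ P.deg j) (n : ℕ) :
    (xMul P ^ n) p ∈ P.deg (j + n) := by
  induction n with
  | zero => simpa using hp
  | succ n ih =>
    rw [pow_succ', Module.End.mul_apply, Nat.cast_succ, ← add_assoc]
    exact x_smul_mem ih

theorem xMul_pow_smul (n : ℕ) (f : k[X]) (p : P.carrier) :
    (xMul P ^ n) (f • p) = f.comp (X + C (-(n : k))) • (xMul P ^ n) p := by
  induction n with
  | zero => simp
  | succ n ih =>
    rw [pow_succ', Module.End.mul_apply, Module.End.mul_apply, ih, xMul_apply, x_smul_poly,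
      comp_assoc, ← xMul_apply]
    congr 2
    simp [add_assoc, add_comm]

/-- Following `x` by `y` is the action of the nonzero polynomial `X + 1`, so the kernel of `x` is
torsion. -/
theorem HomogTorsionFree.eq_zero_of_x_smul (h : HomogTorsionFree P) {j : ℤ} {p : P.carrier}
    (hp : p ∈ P.deg j) (h0 : op (gen k .x) • p = 0) : p = 0 :=
  h j p hp (X + 1) (by simpa using X_add_C_ne_zero (1 : k)) (by rw [← y_smul_x_smul, h0, smul_zero])

theorem HomogTorsionFree.eq_zero_of_xMul_pow (h : HomogTorsionFree P) {j : ℤ} {p : P.carrier}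
    (hp : p ∈ P.deg j) (n : ℕ) (h0 : (xMul P ^ n) p = 0) : p = 0 := by
  induction n with
  | zero => simpa using h0
  | succ n ih =>
    rw [pow_succ', Module.End.mul_apply] at h0
    exact ih (h.eq_zero_of_x_smul (xMul_pow_mem hp n) h0)

theorem XSurjFrom.exists_xMul_pow {N : ℤ} (h : XSurjFrom P N) {j : ℤ} (hj : N ≤ j) (n : ℕ)
    {p : P.carrier} (hp : p ∈ P.deg (j + n)) : ∃ q ∈ P.deg j, (xMul P ^ n) q = p := by
  induction n generalizing p with
  | zero => exact ⟨p, by simpa using hp, rfl⟩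
  | succ n ih =>
    rw [Nat.cast_succ, ← add_assoc] at hp
    obtain ⟨q, hq, rfl⟩ := h _ (by omega) p hp
    obtain ⟨q', hq', rfl⟩ := ih hq
    exact ⟨q', hq', by rw [pow_succ', Module.End.mul_apply, xMul_apply]⟩

/-- Coordinates on the components of a graded module: they are identified with the lattices
in `k[X]^r` that are cut out by subspaces of the fibres at the integers. -/
structure Presentation (P : GrMod (grading k)) (r : ℕ) where
  coord : P.carrier →ₗ[k] (Fin r → k[X])
  fib : ℤ → Submodule k (Fin r → k)
  coord_x : ∀ p, coord (op (gen k .x) • p) = coord p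
  coord_y : ∀ j, ∀ p ∈ P.deg j, coord (op (gen k .y) • p) = (X + C (j : k)) • coord p
  eq_zero_of_coord : ∀ j, ∀ p ∈ P.deg j, coord p = 0 → p = 0
  exists_coord_iff : ∀ j v, (∃ p ∈ P.deg j, coord p = v) ↔
    ∀ i, j ≤ i → vecEval (-(i : k) - 1) v ∈ fib i
  lo : ℤ
  fib_lo : ∀ i < lo, fib i = ⊥
  hi : ℤ
  fib_hi : ∀ i, hi ≤ i → fib i = ⊤

/-- A finitely generated torsion-free module over the principal ideal domain `k[X]` is free.
Coordinates in a basis are twisted by `X ↦ X + N`, the normalization under which `x` will preserve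
coordinates in all degrees. -/
theorem exists_component_coord {N : ℤ} (hfg : (component P N).FG) (ht : HomogTorsionFree P) :
    ∃ (r : ℕ) (γ : component P N →+ (Fin r → k[X])), Function.Bijective γ ∧
      ∀ (f : k[X]) m, γ (f • m) = f.comp (X + C (N : k)) • γ m := by
  have : Module.Finite k[X] (component P N) := Module.Finite.iff_fg.2 hfg
  have : Module.IsTorsionFree k[X] (component P N) := by
    refine Module.isTorsionFree_iff_smul_eq_zero.2 fun f m h => ?_
    by_cases hf : f = 0
    · exact Or.inl hf
    · exact Or.inr (Subtype.ext (ht N m m.2 f hf (congrArg Subtype.val h)))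
  let b := Module.finBasis k[X] (component P N)
  let σ : k[X] ≃ₐ[k] k[X] := algEquivAevalXAddC (N : k)
  have hσ : ∀ f, σ f = f.comp (X + C (N : k)) := fun f => by
    simp [σ, comp, aeval_def, algebraMap_eq]
  refine ⟨_, (AddMonoidHom.pi fun i => (σ : k[X] →+* k[X]).toAddMonoidHom.comp
    (Pi.evalAddMonoidHom (fun _ => k[X]) i)).comp b.equivFun.toLinearMap.toAddMonoidHom, ?_, ?_⟩
  · refine Function.Bijective.comp (g := fun v i => σ (v i)) ⟨fun v w h => ?_, fun v => ?_⟩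
      b.equivFun.bijective
    · exact funext fun i => σ.injective (congrFun h i)
    · exact ⟨fun i => σ.symm (v i), funext fun i => σ.apply_symm_apply _⟩
  · intro f m
    ext1 i
    change σ (b.equivFun (f • m) i) = f.comp (X + C (N : k)) * σ (b.equivFun m i)
    rw [map_smul, Pi.smul_apply, smul_eq_mul, map_mul, hσ]

/-- The coordinates of a graded module on which `x` is eventually bijective. -/
theorem exists_coord {N : ℤ} (hx : XSurjFrom P N) (hfg : (component P N).FG)
    (ht : HomogTorsionFree P) :
    ∃ (r : ℕ) (α : P.carrier →ₗ[k] (Fin r → k[X])),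
      (∀ p, α (op (gen k .x) • p) = α p) ∧
      (∀ j, ∀ p ∈ P.deg j, ∀ f : k[X], α (f • p) = f.comp (X + C (j : k)) • α p) ∧
      (∀ j, ∀ p ∈ P.deg j, α p = 0 → p = 0) ∧
      ∀ j, N ≤ j → ∀ v, ∃ p ∈ P.deg j, α p = v := by
  obtain ⟨r, γ, hγ, hγs⟩ := exists_component_coord hfg ht
  -- The element `m` of degree `N` represents `p` when they agree after multiplication by powers of
  -- `x`. Below `N` one multiplies `p` up (`t = 0`); above `N` one divides by a power of `x` (`s =
  -- 0`).
  have hex : ∀ j (p : P.deg j), ∃ m : component P N, ∃ s t : ℕ, j + s = N + t ∧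
      (xMul P ^ s) (p : P.carrier) = (xMul P ^ t) (m : P.carrier) := by
    rintro j ⟨p, hp⟩
    rcases le_total j N with hj | hj
    · obtain ⟨s, hs⟩ := Int.le.dest hj
      exact ⟨⟨_, hs ▸ xMul_pow_mem hp s⟩, s, 0, by simpa using hs, rfl⟩
    · obtain ⟨t, rfl⟩ := Int.le.dest hj
      obtain ⟨m, hm, hmp⟩ := hx.exists_xMul_pow le_rfl t hp
      exact ⟨⟨m, hm⟩, 0, t, by simp, hmp.symm⟩
  choose β s t hst hβ using hex
  -- Independence of the exponents, by cross-multiplication as for fractions, since powers of `x`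
  -- are injective on homogeneous elements.
  have huniq : ∀ j (p : P.deg j) (m : component P N) (s' t' : ℕ), j + s' = N + t' →
      (xMul P ^ s') (p : P.carrier) = (xMul P ^ t') (m : P.carrier) → β j p = m := by
    intro j p m s' t' h' h
    have h1 : (xMul P ^ (t' + s j p)) ((β j p : P.carrier) - m) = 0 := by
      have e : t' + s j p = s' + t j p := by have := hst j p; omega
      rw [map_sub, sub_eq_zero]
      conv_lhs => rw [e, pow_add, Module.End.mul_apply, ← hβ, ← Module.End.mul_apply,
        ← pow_add, add_comm, pow_add, Module.End.mul_apply, h, ← Module.End.mul_apply, ← pow_add,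
        add_comm]
    exact Subtype.ext (sub_eq_zero.1
      (ht.eq_zero_of_xMul_pow ((P.deg N).sub_mem (β j p).2 m.2) _ h1))
  have hadd : ∀ j (p q : P.deg j), β j (p + q) = β j p + β j q := by
    intro j p q
    obtain ⟨c, h1⟩ | ⟨c, h1⟩ := (le_total (s j p) (s j q)).imp Nat.exists_eq_add_of_le
      Nat.exists_eq_add_of_le
    · refine huniq _ _ _ (s j q) (t j q) (hst j q) ?_
      have e : t j q = c + t j p := by have := hst j p; have := hst j q; omega
      have e1 : (xMul P ^ s j q) (p : P.carrier) = (xMul P ^ t j q) (β j p : P.carrier) := by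
        rw [e, h1, add_comm, pow_add, Module.End.mul_apply, hβ, ← Module.End.mul_apply, ← pow_add]
      rw [AddSubgroup.coe_add, Submodule.coe_add, map_add, map_add, hβ, e1]
    · refine huniq _ _ _ (s j p) (t j p) (hst j p) ?_
      have e : t j p = c + t j q := by have := hst j p; have := hst j q; omega
      have e1 : (xMul P ^ s j p) (q : P.carrier) = (xMul P ^ t j p) (β j q : P.carrier) := by
        rw [e, h1, add_comm, pow_add, Module.End.mul_apply, hβ, ← Module.End.mul_apply, ← pow_add]
      rw [AddSubgroup.coe_add, Submodule.coe_add, map_add, map_add, hβ, e1]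
  obtain ⟨F, hF⟩ := P.exists_addMonoidHom_of_deg fun j => γ.comp (AddMonoidHom.mk' (β j) (hadd j))
  have hFm : ∀ j, ∀ p ∈ P.deg j, ∃ (m : component P N) (s t : ℕ), j + s = N + t ∧
      (xMul P ^ s) p = (xMul P ^ t) (m : P.carrier) ∧ F p = γ m := fun j p hp =>
    ⟨β j ⟨p, hp⟩, _, _, hst j _, hβ j ⟨p, hp⟩, hF j p hp⟩
  have hFu : ∀ j, ∀ p ∈ P.deg j, ∀ (m : component P N) (s t : ℕ), j + s = N + t →
      (xMul P ^ s) p = (xMul P ^ t) (m : P.carrier) → F p = γ m := fun j p hp m s t h h' => by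
    rw [hF j p hp]
    exact congrArg γ (huniq j ⟨p, hp⟩ m s t h h')
  have hFpoly : ∀ j, ∀ p ∈ P.deg j, ∀ f : k[X], F (f • p) = f.comp (X + C (j : k)) • F p := by
    intro j p hp f
    obtain ⟨m, s, t, h1, h2, h3⟩ := hFm j p hp
    -- Passing `x ^ s` and `x ^ t` shifts the variable by `-s` and `-t`, and `t - s = j - N`. So `f`
    -- acts on the representative as `f(X + j - N)`, and the twist in `γ` adds `N`.
    rw [hFu j (f • p) ((component P j).smul_mem f hp) (f.comp (X + C (j - N : k)) • m) s t h1,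
      hγs, h3, comp_assoc]
    · congr 2
      simp [add_assoc]
    · rw [xMul_pow_smul, h2, Submodule.coe_smul, xMul_pow_smul, comp_assoc]
      congr 2
      have : (j : k) + s = N + t := by exact_mod_cast congrArg (Int.cast : ℤ → k) h1
      simp only [add_comp, X_comp, C_comp, add_assoc, ← C_add]
      congr 2
      linear_combination -this
  refine ⟨r, ⟨F.toAddHom, fun c p => ?_⟩, fun p => ?_, hFpoly, fun j p hp h => ?_,
    fun j hj v => ?_⟩
  · change F (c • p) = c • F p
    induction p using induction_on_homogeneous with
    | h0 => simp
    | hh j p hp =>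
      have := hFpoly j p hp (C c)
      rw [C_comp] at this
      rw [← algebraMap_smul k[X] c p, ← algebraMap_smul k[X] c (F p)]
      exact this
    | hadd p q hp hq => rw [smul_add, map_add, map_add, smul_add, hp, hq]
  · change F _ = F _
    induction p using induction_on_homogeneous with
    | h0 => simp
    | hh j p hp =>
      obtain ⟨m, s, t, h1, h2, h3⟩ := hFm j p hp
      rw [h3]
      refine hFu (j + 1) _ (x_smul_mem hp) m s (t + 1) (by push_cast; omega) ?_
      rw [pow_succ' (xMul P) t, Module.End.mul_apply, ← h2, ← Module.End.mul_apply, ← pow_succ',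
        pow_succ, Module.End.mul_apply, xMul_apply]
    | hadd p q hp hq => rw [smul_add, map_add, map_add, hp, hq]
  · obtain ⟨m, s, t, h1, h2, h3⟩ := hFm j p hp
    have h4 : γ m = 0 := h3 ▸ h
    rw [(map_eq_zero_iff γ hγ.1).1 h4, Submodule.coe_zero, map_zero] at h2
    exact ht.eq_zero_of_xMul_pow hp s h2
  · obtain ⟨m, rfl⟩ := hγ.2 v
    obtain ⟨t, rfl⟩ := Int.le.dest hj
    exact ⟨_, xMul_pow_mem m.2 t, hFu (N + t) _ (xMul_pow_mem m.2 t) m 0 t (by simp) rfl⟩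

/-- The images `Λ j` of the components satisfy the hypotheses of `mem_chain_iff`: `x` gives the
inclusions, and `y` gives the multiplications by linear polynomials. The subspace `fib i` is the
image of `Λ i` in the fibre at `-i - 1`. -/
theorem exists_presentation [CharZero k] (P : FGProj (grading k)) :
    ∃ r, Nonempty (Presentation P.toGrMod r) := by
  obtain ⟨⟨N, hN⟩, ⟨M, hM⟩, hfg, ht⟩ := exists_properties P
  obtain ⟨r, α, hx, hpoly, h0, htop⟩ := exists_coord hN (hfg N) ht
  have hy : ∀ j, ∀ p ∈ P.toGrMod.deg j,
      α (op (gen k .y) • p) = (X + C (j : k)) • α p := fun j p hp => by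
    rw [← hx, x_smul_y_smul, hpoly j p hp, X_comp]
  let Λ : ℤ → Submodule k[X] (Fin r → k[X]) := fun j =>
    { carrier := {v | ∃ p ∈ P.toGrMod.deg j, α p = v}
      zero_mem' := ⟨0, (P.toGrMod.deg j).zero_mem, map_zero α⟩
      add_mem' := by
        rintro _ _ ⟨p, hp, rfl⟩ ⟨q, hq, rfl⟩
        exact ⟨p + q, (P.toGrMod.deg j).add_mem hp hq, map_add α _ _⟩
      smul_mem' := by
        rintro f _ ⟨p, hp, rfl⟩
        -- The shift by `-j` undoes the twist of the action in degree `j`.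
        refine ⟨f.comp (X + C (-(j : k))) • p, (component P.toGrMod j).smul_mem _ hp, ?_⟩
        rw [hpoly j p hp, comp_assoc]
        simp }
  refine ⟨r, ⟨α, fun i => ((Λ i).restrictScalars k).map (vecEval (-(i : k) - 1)), hx, hy, h0,
    mem_chain_iff Λ ?_ ?_ (N := N) ?_, M, fun i hi => ?_, N, fun i hi => ?_⟩⟩
  · rintro j _ ⟨p, hp, rfl⟩
    exact ⟨_, x_smul_mem hp, hx p⟩
  · rintro j _ ⟨p, hp, rfl⟩
    refine ⟨op (gen k .y) • p, ?_, ?_⟩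
    · have := y_smul_mem hp
      rwa [add_sub_cancel_right] at this
    · rw [hy _ p hp]
      push_cast
      rfl
  · exact fun j hj => eq_top_iff.2 fun v _ => htop j hj v
  · rw [eq_bot_iff]
    rintro _ ⟨_, ⟨p, hp, rfl⟩, rfl⟩
    -- Below `M` every element of degree `i` is a multiple by `y` from degree `i + 1`, so its
    -- coordinates are divisible by `X + i + 1` and vanish at `-i - 1`.
    obtain ⟨q, hq, rfl⟩ := hM (i + 1) (by omega) p (by rwa [add_sub_cancel_right])
    rw [hy _ q hq, vecEval_smul]
    simp
  · rw [eq_top_iff]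
    exact fun w _ => ⟨vecConst w, htop i hi _, vecEval_vecConst _ _⟩

end Weyl

/-! ### The dimensions of the cokernels of `x` -/

namespace Weyl

open Polynomial GrMod

variable {k : Type u} [Field k] {P Q : GrMod (grading k)}

/-- The dimension of `P_{j+1} / P_j x`. -/
noncomputable def defect (P : GrMod (grading k)) (j : ℤ) : ℕ :=
  Module.finrank k (↥((component P (j + 1)).restrictScalars k) ⧸
    (((component P j).restrictScalars k).map (xMul P)).submoduleOf
      ((component P (j + 1)).restrictScalars k))

theorem defect_eq_finrank {Z : Type*} [AddCommGroup Z] [Module k Z] {j : ℤ}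
    (g : P.carrier →ₗ[k] Z) (hg : ∀ z, ∃ p ∈ P.deg (j + 1), g p = z)
    (hk : ∀ p ∈ P.deg (j + 1), g p = 0 ↔ ∃ q ∈ P.deg j, op (gen k .x) • q = p) :
    defect P j = Module.finrank k Z := by
  let g' := g ∘ₗ ((component P (j + 1)).restrictScalars k).subtype
  have hker : (((component P j).restrictScalars k).map (xMul P)).submoduleOf
      ((component P (j + 1)).restrictScalars k) = LinearMap.ker g' := by
    ext p
    exact (hk p p.2).symm
  have hsurj : Function.Surjective g' := fun z => by
    obtain ⟨p, hp, rfl⟩ := hg z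
    exact ⟨⟨p, hp⟩, rfl⟩
  rw [defect, hker]
  exact (g'.quotKerEquivOfSurjective hsurj).finrank_eq

namespace Presentation

/-- The map from `P_{j+1}` onto the quotient of the fibre that identifies `P_{j+1} / P_j x`. -/
noncomputable def toFibre {r : ℕ} (A : Presentation P r) (j : ℤ) :
    P.carrier →ₗ[k] (Fin r → k) ⧸ A.fib j :=
  (A.fib j).mkQ ∘ₗ vecEval (-(j : k) - 1) ∘ₗ A.coord

theorem toFibre_surjective [CharZero k] {r : ℕ} (A : Presentation P r) (j : ℤ)
    (z : (Fin r → k) ⧸ A.fib j) : ∃ p ∈ P.deg (j + 1), A.toFibre j p = z := by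
  obtain ⟨w, rfl⟩ := (A.fib j).mkQ_surjective z
  -- Membership in degree `j + 1` constrains only the points of index in `[j + 1, hi)`. Vanishing
  -- there meets these constraints and leaves the value at `-j - 1` free.
  obtain ⟨v, hv, hv0⟩ := exists_vecEval_eq (Finset.Ico (j + 1) A.hi) (j := j) (by simp) w
  obtain ⟨p, hp, rfl⟩ := (A.exists_coord_iff (j + 1) v).2 fun i hi => by
    by_cases h : i < A.hi
    · rw [hv0 i (Finset.mem_Ico.2 ⟨hi, h⟩)]
      exact (A.fib i).zero_mem
    · rw [A.fib_hi i (not_lt.1 h)]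
      trivial
  exact ⟨p, hp, congrArg _ hv⟩

theorem coord_injOn {r : ℕ} (A : Presentation P r) {j : ℤ} {p q : P.carrier} (hp : p ∈ P.deg j)
    (hq : q ∈ P.deg j) (h : A.coord p = A.coord q) : p = q :=
  sub_eq_zero.1 (A.eq_zero_of_coord j _ ((P.deg j).sub_mem hp hq) (by rw [map_sub, h, sub_self]))

/-- The lattices in degrees `j` and `j + 1` differ by exactly one fibre condition, the one of index
`j`. -/
theorem toFibre_eq_zero_iff {r : ℕ} (A : Presentation P r) (j : ℤ) {p : P.carrier}
    (hp : p ∈ P.deg (j + 1)) :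
    A.toFibre j p = 0 ↔ ∃ q ∈ P.deg j, op (gen k .x) • q = p := by
  have h1 : A.toFibre j p = 0 ↔ vecEval (-(j : k) - 1) (A.coord p) ∈ A.fib j :=
    Submodule.Quotient.mk_eq_zero _
  rw [h1]
  constructor
  · intro h
    obtain ⟨q, hq, hqp⟩ := (A.exists_coord_iff j (A.coord p)).2 fun i hi => by
      rcases hi.eq_or_lt with rfl | hi
      · exact h
      · exact (A.exists_coord_iff (j + 1) _).1 ⟨p, hp, rfl⟩ i (by omega)
    exact ⟨q, hq, A.coord_injOn (x_smul_mem hq) hp (by rw [A.coord_x, hqp])⟩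
  · rintro ⟨q, hq, rfl⟩
    rw [A.coord_x]
    exact (A.exists_coord_iff j _).1 ⟨q, hq, rfl⟩ j le_rfl

theorem defect_eq [CharZero k] {r : ℕ} (A : Presentation P r) (j : ℤ) :
    defect P j = Module.finrank k ((Fin r → k) ⧸ A.fib j) :=
  defect_eq_finrank (A.toFibre j) (A.toFibre_surjective j) fun _ => A.toFibre_eq_zero_iff j

theorem defect_add_finrank [CharZero k] {r : ℕ} (A : Presentation P r) (j : ℤ) :
    defect P j + Module.finrank k (A.fib j) = r := by
  rw [A.defect_eq, Submodule.finrank_quotient_add_finrank, Module.finrank_fin_fun]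

theorem defect_eq_of_lt_lo [CharZero k] {r : ℕ} (A : Presentation P r) {j : ℤ} (hj : j < A.lo) :
    defect P j = r := by
  have := A.defect_add_finrank j
  rwa [A.fib_lo j hj, finrank_bot, add_zero] at this

theorem defect_eq_zero [CharZero k] {r : ℕ} (A : Presentation P r) {j : ℤ} (hj : A.hi ≤ j) :
    defect P j = 0 := by
  have := A.defect_add_finrank j
  rw [A.fib_hi j hj, finrank_top, Module.finrank_fin_fun] at this
  omega

/-- The fibre conditions describe the lattices, so `ψ` carries those of `P` into those of `Q` and
lifts uniquely to each component. In coordinates `x` is the identity and `y` a polynomial multiple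
depending only on the degree, so the lift commutes with both. -/
theorem exists_map {r : ℕ} (A : Presentation P r) (B : Presentation Q r)
    (ψ : (Fin r → k[X]) ≃ₗ[k[X]] (Fin r → k[X]))
    (hψ : ∀ (i : ℤ) v, vecEval (-(i : k) - 1) (ψ v) ∈ B.fib i ↔
      vecEval (-(i : k) - 1) v ∈ A.fib i) :
    ∃ F : P.carrier →ₗ[(Weyl k)ᵐᵒᵖ] Q.carrier,
      ∀ j, ∀ p ∈ P.deg j, F p ∈ Q.deg j ∧ B.coord (F p) = ψ (A.coord p) := by
  have hex : ∀ j (p : P.deg j), ∃ q ∈ Q.deg j, B.coord q = ψ (A.coord p) := fun j p =>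
    (B.exists_coord_iff j _).2 fun i hi =>
      (hψ i _).2 ((A.exists_coord_iff j _).1 ⟨p, p.2, rfl⟩ i hi)
  choose φ hφ hφc using hex
  obtain ⟨F, hF⟩ := P.exists_addMonoidHom_of_deg fun j => AddMonoidHom.mk' (φ j) fun p q =>
    B.coord_injOn (hφ j _) ((Q.deg j).add_mem (hφ j p) (hφ j q)) (by
      rw [map_add, hφc, hφc, hφc, AddSubgroup.coe_add, map_add, map_add])
  have hFd : ∀ j, ∀ p ∈ P.deg j, F p ∈ Q.deg j ∧ B.coord (F p) = ψ (A.coord p) := by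
    intro j p hp
    rw [hF j p hp]
    exact ⟨hφ j ⟨p, hp⟩, hφc j ⟨p, hp⟩⟩
  have hx : ∀ p, F (op (gen k .x) • p) = op (gen k .x) • F p := fun p => by
    induction p using induction_on_homogeneous with
    | h0 => simp
    | hh j p hp =>
      refine B.coord_injOn (hFd _ _ (x_smul_mem hp)).1 (x_smul_mem (hFd _ _ hp).1) ?_
      rw [(hFd _ _ (x_smul_mem hp)).2, A.coord_x, B.coord_x, (hFd _ _ hp).2]
    | hadd p q hp hq => rw [smul_add, map_add, map_add, smul_add, hp, hq]
  have hy : ∀ p, F (op (gen k .y) • p) = op (gen k .y) • F p := fun p => by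
    induction p using induction_on_homogeneous with
    | h0 => simp
    | hh j p hp =>
      refine B.coord_injOn (hFd _ _ (y_smul_mem hp)).1 (y_smul_mem (hFd _ _ hp).1) ?_
      rw [(hFd _ _ (y_smul_mem hp)).2, A.coord_y j p hp, B.coord_y j _ (hFd _ _ hp).1,
        (hFd _ _ hp).2, map_smul]
    | hadd p q hp hq => rw [smul_add, map_add, map_add, smul_add, hp, hq]
  have hc : ∀ (c : k) p, F (op (algebraMap k (Weyl k) c) • p) =
      op (algebraMap k (Weyl k) c) • F p := fun c p => by
    simp only [← base_smul_def]
    induction p using induction_on_homogeneous with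
    | h0 => simp
    | hh j p hp =>
      refine B.coord_injOn (hFd _ _ (base_smul_mem c hp)).1 (base_smul_mem c (hFd _ _ hp).1) ?_
      rw [(hFd _ _ (base_smul_mem c hp)).2, A.coord.map_smul, B.coord.map_smul, (hFd _ _ hp).2,
        ← algebraMap_smul k[X] c (A.coord p), map_smul, algebraMap_smul]
    | hadd p q hp hq => rw [smul_add, map_add, map_add, smul_add, hp, hq]
  refine ⟨⟨F.toAddHom, fun a p => ?_⟩, hFd⟩
  change F (a • p) = a • F p
  obtain ⟨a, rfl⟩ := op_surjective a
  obtain ⟨a, rfl⟩ := RingQuot.mkAlgHom_surjective k (WeylRel k) a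
  induction a using FreeAlgebra.induction generalizing p with
  | grade0 c => rw [AlgHom.commutes]; exact hc c p
  | grade1 g =>
    cases g with
    | x => exact hx p
    | y => exact hy p
  | mul a b ha hb => rw [map_mul, op_mul, mul_smul, mul_smul, hb, ha]
  | add a b ha hb => rw [map_add, op_add, add_smul, add_smul, map_add, ha, hb]

theorem nonempty_grIso {r : ℕ} (A : Presentation P r) (B : Presentation Q r)
    (ψ : (Fin r → k[X]) ≃ₗ[k[X]] (Fin r → k[X]))
    (hψ : ∀ (i : ℤ) v, vecEval (-(i : k) - 1) (ψ v) ∈ B.fib i ↔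
      vecEval (-(i : k) - 1) v ∈ A.fib i) : Nonempty (GrIso P Q) := by
  obtain ⟨F, hF⟩ := A.exists_map B ψ hψ
  obtain ⟨G, hG⟩ := B.exists_map A ψ.symm fun i v => by
    rw [← hψ, LinearEquiv.apply_symm_apply]
  have hFG : ∀ q, F (G q) = q := fun q => by
    induction q using induction_on_homogeneous with
    | h0 => simp
    | hh j q hq =>
      refine B.coord_injOn (hF j _ (hG j q hq).1).1 hq ?_
      rw [(hF j _ (hG j q hq).1).2, (hG j q hq).2, LinearEquiv.apply_symm_apply]
    | hadd p q hp hq => rw [map_add, map_add, hp, hq]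
  have hGF : ∀ p, G (F p) = p := fun p => by
    induction p using induction_on_homogeneous with
    | h0 => simp
    | hh j p hp =>
      refine A.coord_injOn (hG j _ (hF j p hp).1).1 hp ?_
      rw [(hG j _ (hF j p hp).1).2, (hF j p hp).2, LinearEquiv.symm_apply_apply]
    | hadd p q hp hq => rw [map_add, map_add, hp, hq]
  refine ⟨⟨LinearEquiv.ofLinearMap F G (LinearMap.ext hFG) (LinearMap.ext hGF), fun i m =>
    ⟨fun h => ?_, fun h => (hF i m h).1⟩⟩⟩
  have := (hG i _ h).1
  rwa [LinearEquiv.coe_ofLinearMap, hGF] at this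

end Presentation

/-- Degree `j + 1` of the shift is degree `j + 1 - n` of the algebra. If this is `-m ≤ 0`, the
functional `lead k m` identifies the cokernel with `k`; if it is positive, `x` is surjective. -/
theorem defect_free (n j : ℤ) :
    defect (FGProj.free (grading k) n).toGrMod j = if j < n then 1 else 0 := by
  split_ifs with h
  · obtain ⟨m, hm⟩ := Int.le.dest (show j + 1 ≤ n by omega)
    let g : (FGProj.free (grading k) n).toGrMod.carrier →ₗ[k] k :=
      { toFun := lead k m
        map_add' := map_add (lead k m)
        map_smul' := fun c (a : Weyl k) => by
          change lead k m (a * algebraMap k (Weyl k) c) = c • lead k m a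
          rw [← Algebra.commutes, ← Algebra.smul_def, map_smul] }
    rw [defect_eq_finrank g (fun z => ?_) fun a ha => ?_, Module.finrank_self]
    · refine ⟨(z • gen k .y ^ m : Weyl k), ?_, ?_⟩
      · have := (grading k (-m)).smul_mem z (y_pow_mem m)
        rwa [show -(m : ℤ) = j + 1 - n by omega] at this
      · refine (map_smul (lead k m) z _).trans ?_
        rw [lead_y_pow, smul_eq_mul, mul_one]
    · have ha' : a ∈ grading k (-m) := by
        rw [show -(m : ℤ) = j + 1 - n by omega]
        exact ha
      refine (lead_eq_zero_iff ha').trans ?_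
      rw [show -(m : ℤ) - 1 = j - n by omega]
      rfl
  · rw [defect_eq_finrank (0 : _ →ₗ[k] PUnit.{1}) (fun z => ⟨0, AddSubgroup.zero_mem _, rfl⟩)
      fun a ha => ?_, Module.finrank_zero_of_subsingleton]
    refine ⟨fun _ => ?_, fun _ => rfl⟩
    obtain ⟨b, hb, hba⟩ := exists_mul_x_eq (k := k) (n := j - n) (by omega) (a := a) (by
      rw [sub_add_eq_add_sub]; exact ha)
    exact ⟨b, hb, hba⟩

/-! ### Classification by the defects, and their additivity -/

variable [CharZero k]

/-- A finitely generated graded projective module is determined by the dimensions of the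
cokernels of `x`. -/
theorem nonempty_grIso_of_defect_eq (P Q : FGProj (grading k))
    (h : ∀ j, defect P.toGrMod j = defect Q.toGrMod j) :
    Nonempty (GrIso P.toGrMod Q.toGrMod) := by
  obtain ⟨r, ⟨A⟩⟩ := exists_presentation P
  obtain ⟨r', ⟨B⟩⟩ := exists_presentation Q
  -- Both ranks are the value of the defect far enough to the left.
  obtain rfl : r = r' := by
    rw [← A.defect_eq_of_lt_lo (j := min A.lo B.lo - 1) (by omega), h,
      B.defect_eq_of_lt_lo (by omega)]
  obtain ⟨ψ, hψ⟩ := exists_equiv_of_finrank_eq A.fib B.fib (fun i => by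
    have h1 := A.defect_add_finrank i
    have h2 := B.defect_add_finrank i
    have h3 := h i
    omega) A.fib_lo A.fib_hi
  exact A.nonempty_grIso B ψ hψ

theorem defect_eq_of_grIso (P Q : FGProj (grading k)) (e : GrIso P.toGrMod Q.toGrMod) (j : ℤ) :
    defect P.toGrMod j = defect Q.toGrMod j := by
  obtain ⟨r, ⟨B⟩⟩ := exists_presentation Q
  rw [B.defect_eq]
  let e' := e.toLinearEquiv
  refine defect_eq_finrank (B.toFibre j ∘ₗ
    ⟨e'.toLinearMap.toAddHom, fun c p => map_smul e' _ _⟩) (fun z => ?_) fun p hp => ?_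
  · obtain ⟨q, hq, rfl⟩ := B.toFibre_surjective j z
    exact ⟨e'.symm q, (e.symm.map_deg_iff _ _).2 hq,
      congrArg (B.toFibre j) (e'.apply_symm_apply q)⟩
  · refine (B.toFibre_eq_zero_iff j ((e.map_deg_iff _ _).2 hp)).trans ⟨?_, ?_⟩
    · rintro ⟨q, hq, hqp⟩
      refine ⟨e'.symm q, (e.symm.map_deg_iff _ _).2 hq, e'.injective ?_⟩
      rw [map_smul, LinearEquiv.apply_symm_apply]
      exact hqp
    · rintro ⟨q, hq, rfl⟩
      exact ⟨e' q, (e.map_deg_iff _ _).2 hq, (map_smul e' _ _).symm⟩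

/-- Presentations replace both cokernels by quotients of finite-dimensional fibres, where `finrank`
is additive on products. -/
theorem defect_sum (P Q : FGProj (grading k)) (j : ℤ) :
    defect (P.sum Q).toGrMod j = defect P.toGrMod j + defect Q.toGrMod j := by
  obtain ⟨r, ⟨A⟩⟩ := exists_presentation P
  obtain ⟨r', ⟨B⟩⟩ := exists_presentation Q
  rw [A.defect_eq, B.defect_eq, ← Module.finrank_prod]
  let g : (P.sum Q).toGrMod.carrier →ₗ[k]
      ((Fin r → k) ⧸ A.fib j) × ((Fin r' → k) ⧸ B.fib j) :=
    { toFun := fun p => (A.toFibre j p.1, B.toFibre j p.2)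
      map_add' := fun p q => Prod.ext (map_add _ p.1 q.1) (map_add _ p.2 q.2)
      map_smul' := fun c p => Prod.ext (map_smul _ c p.1) (map_smul _ c p.2) }
  refine defect_eq_finrank g (fun z => ?_) fun p hp => ?_
  · obtain ⟨p, hp, hpz⟩ := A.toFibre_surjective j z.1
    obtain ⟨q, hq, hqz⟩ := B.toFibre_surjective j z.2
    exact ⟨(p, q), ⟨hp, hq⟩, Prod.ext hpz hqz⟩
  · refine Prod.ext_iff.trans ((and_congr (A.toFibre_eq_zero_iff j hp.1)
      (B.toFibre_eq_zero_iff j hp.2)).trans ⟨?_, ?_⟩)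
    · rintro ⟨⟨q, hq, hqp⟩, ⟨q', hq', hqp'⟩⟩
      exact ⟨(q, q'), ⟨hq, hq'⟩, Prod.ext hqp hqp'⟩
    · rintro ⟨q, hq, rfl⟩
      exact ⟨⟨q.1, hq.1, rfl⟩, ⟨q.2, hq.2, rfl⟩⟩

/-! ### The Grothendieck group -/

theorem finite_support_defect_sub (P : FGProj (grading k)) :
    (Function.support fun n : ℤ =>
      (defect P.toGrMod (n - 1) : ℤ) - defect P.toGrMod n).Finite := by
  obtain ⟨r, ⟨A⟩⟩ := exists_presentation P
  refine (Set.finite_Icc A.lo A.hi).subset fun n hn => ?_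
  by_contra h
  rw [Set.mem_Icc, not_and_or, not_le, not_le] at h
  refine hn ?_
  rcases h with h | h
  · simp [A.defect_eq_of_lt_lo h, A.defect_eq_of_lt_lo (show n - 1 < A.lo by omega)]
  · simp [A.defect_eq_zero h.le, A.defect_eq_zero (show A.hi ≤ n - 1 by omega)]

/-- The jumps of the dimensions of the cokernels of `x`. -/
noncomputable def jumps (P : FGProj (grading k)) : ℤ →₀ ℤ :=
  Finsupp.ofSupportFinite _ (finite_support_defect_sub P)

theorem jumps_apply (P : FGProj (grading k)) (n : ℤ) :
    jumps P n = (defect P.toGrMod (n - 1) : ℤ) - defect P.toGrMod n := rfl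

theorem jumps_sum (P Q : FGProj (grading k)) : jumps (P.sum Q) = jumps P + jumps Q := by
  ext n
  rw [Finsupp.add_apply, jumps_apply, jumps_apply, jumps_apply, defect_sum, defect_sum]
  push_cast
  ring

theorem jumps_free (n : ℤ) : jumps (FGProj.free (grading k) n) = Finsupp.single n 1 := by
  ext j
  rw [jumps_apply, defect_free, defect_free, Finsupp.single_apply]
  split_ifs <;> first | rfl | omega

theorem jumps_eq_of_grIso {P Q : FGProj (grading k)} (e : GrIso P.toGrMod Q.toGrMod) :
    jumps P = jumps Q := by
  ext n
  rw [jumps_apply, jumps_apply, defect_eq_of_grIso P Q e, defect_eq_of_grIso P Q e]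

/-- The defects vanish far to the right, so they are recovered from their differences by descending
induction. -/
theorem nonempty_grIso_of_jumps_eq {P Q : FGProj (grading k)} (h : jumps P = jumps Q) :
    Nonempty (GrIso P.toGrMod Q.toGrMod) := by
  refine nonempty_grIso_of_defect_eq P Q fun j => ?_
  obtain ⟨r, ⟨A⟩⟩ := exists_presentation P
  obtain ⟨r', ⟨B⟩⟩ := exists_presentation Q
  rcases le_total (max A.hi B.hi) j with hj | hj
  · rw [A.defect_eq_zero (by omega), B.defect_eq_zero (by omega)]
  induction j, hj using Int.leInductionDown with
  | base => rw [A.defect_eq_zero (by omega), B.defect_eq_zero (by omega)]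
  | pred j _ ih =>
    have := DFunLike.congr_fun h j
    rw [jumps_apply, jumps_apply] at this
    omega

variable (k) in
/-- The jumps as a homomorphism on the monoid of isomorphism classes. -/
noncomputable def jumpsClass : FGProjClass (grading k) →+ (ℤ →₀ ℤ) where
  toFun := Quotient.lift jumps fun _ _ ⟨e⟩ => jumps_eq_of_grIso e
  map_zero' := by
    have h : jumps (FGProj.zero (grading k)) =
        jumps (FGProj.zero (grading k)) + jumps (FGProj.zero (grading k)) := by
      rw [← jumps_sum]
      exact (jumps_eq_of_grIso (Quotient.exact
        (zero_add (0 : FGProjClass (grading k)))).some).symm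
    exact left_eq_add.1 h
  map_add' := by
    rintro ⟨P⟩ ⟨Q⟩
    exact jumps_sum P Q

theorem jumpsClass_injective : Function.Injective (jumpsClass k) := by
  rintro ⟨P⟩ ⟨Q⟩ h
  exact Quotient.sound (nonempty_grIso_of_jumps_eq h)

variable (k) in
/-- The jumps as a homomorphism on the Grothendieck group. -/
noncomputable def jumpsK0 : GrK0 (grading k) →+ (ℤ →₀ ℤ) :=
  Algebra.GrothendieckAddGroup.lift (jumpsClass k)

theorem jumpsK0_of (c : FGProjClass (grading k)) :
    jumpsK0 k (Algebra.GrothendieckAddGroup.of c) = jumpsClass k c :=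
  DFunLike.congr_fun (Algebra.GrothendieckAddGroup.lift.symm_apply_apply (jumpsClass k)) c

theorem jumpsK0_cls (P : FGProj (grading k)) : jumpsK0 k (GrK0.cls P) = jumps P :=
  jumpsK0_of _

/-- Every element of `K₀` is a difference `[a] - [b]`. If it maps to `0`, then `a` and `b` have the
same jumps, hence already coincide in the monoid of classes. -/
theorem jumpsK0_injective : Function.Injective (jumpsK0 k) := by
  refine (injective_iff_map_eq_zero _).2 fun z hz => ?_
  obtain ⟨⟨a, b⟩, h⟩ := (AddLocalization.addMonoidOf (⊤ : AddSubmonoid _)).surj z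
  have h' : z + Algebra.GrothendieckAddGroup.of (b : FGProjClass (grading k)) =
      Algebra.GrothendieckAddGroup.of a := h
  have h1 := congrArg (jumpsK0 k) h'
  rw [map_add, hz, zero_add, jumpsK0_of, jumpsK0_of] at h1
  rw [jumpsClass_injective h1] at h'
  exact add_eq_right.1 h'

theorem jumpsK0_surjective : Function.Surjective (jumpsK0 k) := by
  intro f
  induction f using Finsupp.induction_linear with
  | zero => exact ⟨0, map_zero _⟩
  | add f g hf hg =>
    obtain ⟨a, rfl⟩ := hf
    obtain ⟨b, rfl⟩ := hg
    exact ⟨a + b, map_add _ _ _⟩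
  | single n c =>
    refine ⟨c • GrK0.cls (FGProj.free (grading k) n), ?_⟩
    rw [map_zsmul, jumpsK0_cls, jumps_free, Finsupp.smul_single, smul_eq_mul, mul_one]

theorem nonempty_grIso_of_cls_eq {P Q : FGProj (grading k)} (h : GrK0.cls P = GrK0.cls Q) :
    Nonempty (GrIso P.toGrMod Q.toGrMod) :=
  nonempty_grIso_of_jumps_eq (by rw [← jumpsK0_cls, h, jumpsK0_cls])

end Weyl

theorem proposition7p2 {k : Type u} [Field k] [IsAlgClosed k] [CharZero k] :
    (∃ b : Module.Basis ℤ ℤ (GrK0 (Weyl.grading k)),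
      ∀ n : ℤ, b n = GrK0.cls (FGProj.free (Weyl.grading k) n)) ∧
    (∀ P P' : FGProj (Weyl.grading k),
      GrK0.cls P = GrK0.cls P' ↔ Nonempty (GrIso P.toGrMod P'.toGrMod)) ∧
    (∀ P P' Q : FGProj (Weyl.grading k),
      Nonempty (GrIso (P.sum Q).toGrMod (P'.sum Q).toGrMod) →
        Nonempty (GrIso P.toGrMod P'.toGrMod)) := by
  refine ⟨⟨⟨(AddEquiv.ofBijective (Weyl.jumpsK0 k)
    ⟨Weyl.jumpsK0_injective, Weyl.jumpsK0_surjective⟩).toIntLinearEquiv⟩, fun n => ?_⟩,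
    fun P P' => ⟨Weyl.nonempty_grIso_of_cls_eq, fun h => ?_⟩, fun P P' Q ⟨e⟩ => ?_⟩
  · refine Weyl.jumpsK0_injective (Eq.trans ?_
      ((Weyl.jumpsK0_cls _).trans (Weyl.jumps_free n)).symm)
    exact AddEquiv.apply_symm_apply (AddEquiv.ofBijective (Weyl.jumpsK0 k)
      ⟨Weyl.jumpsK0_injective, Weyl.jumpsK0_surjective⟩) _
  · exact congrArg Algebra.GrothendieckAddGroup.of (Quotient.sound h)
  -- Cancellation takes place in the group `ℤ →₀ ℤ`, since the jumps are additive and determine the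
  -- module.
  · refine Weyl.nonempty_grIso_of_jumps_eq ?_
    have := Weyl.jumps_eq_of_grIso e
    rwa [Weyl.jumps_sum, Weyl.jumps_sum, add_left_inj] at this
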